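/- Let $T$ be an arbitrary index set (for $T=\{1,\dots,d\}$ the processes below are random vectors in $\mathbb R^d$), and let $\xi=(\xi_t)_{t\in T}$ and $\xi^*=(\xi^*_t)_{t\in T}$ be real stochastic processes with all $\xi_t$, $\xi^*_t$ integrable. Let $\xi^{(1)},\xi^{(2)},\dots$ be i.i.d. copies of $\xi$, let $\zeta_1,\zeta_2,\dots$ be i.i.d. standard exponential random variables independent of $(\xi^{(k)})_{k\ge1}$, and put $\Gamma_k=\zeta_1+\dots+\zeta_k$. Let $\xi^{*(k)}$ and $\Gamma^*_k$ be given in the same way for $\xi^*$, possibly on another probability space. Call $\xi$ and $\xi^*$ zonoid equivalent if $$\mathbf E\Bigl|\sum_{t\in I}u_t\xi_t\Bigr|=\mathbf E\Bigl|\sum_{t\in I}u_t\xi^*_t\Bigr|\qquad\text{for all finite } I\subset T \text{ and all } u\in\mathbb R^I .$$ (i) Suppose that $\xi$ and $\xi^*$ are symmetric, i.e. $\xi$ and $-\xi$ have the same law, and likewise $\xi^*$ and $-\xi^*$. Then for each $t\in T$ the series $$X_t=\sum_{k=1}^\infty\Gamma_k^{-1}\xi^{(k)}_t,\qquad X^*_t=\sum_{k=1}^\infty(\Gamma^*_k)^{-1}\xi^{*(k)}_t$$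 converge almost surely (as limits of partial sums), and $X$ and $X^*$ have the same finite-dimensional distributions if and only if $\xi$ and $\xi^*$ are zonoid equivalent. (ii) Suppose that for each $t\in T$ one has $\xi_t\ge0$ and $\xi^*_t\ge0$ almost surely (in particular, this covers positive processes). Then for each $t\in T$ the maxima $$Y_t=\max_{k\ge1}\Gamma_k^{-1}\xi^{(k)}_t,\qquad Y^*_t=\max_{k\ge1}(\Gamma^*_k)^{-1}\xi^{*(k)}_t$$ exist almost surely, and $Y$ and $Y^*$ have the same finite-dimensional distributions if and only if $\xi$ and $\xi^*$ are zonoid equivalent. -/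

import Mathlib

open MeasureTheory ProbabilityTheory Filter Topology

/-- Two random vectors `ξ`, `ξ'` (with finitely many real coordinates), integrable in all uses below,
are zonoid equivalent: `E|⟨u, ξ⟩| = E|⟨u, ξ'⟩|` for every `u`, i.e. the support functions of
their centred zonoids coincide. -/
def VectorZonoidEquivalent {ι S S' : Type*} [Fintype ι] [MeasurableSpace S] [MeasurableSpace S']
    (ξ : S → ι → ℝ) (ξ' : S' → ι → ℝ) (Q : Measure S) (Q' : Measure S') : Prop :=
  ∀ u : ι → ℝ, ∫ s, |∑ i, u i * ξ s i| ∂Q = ∫ s, |∑ i, u i * ξ' s i| ∂Q'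

/-- Two families of random variables indexed by `T` are zonoid equivalent if all their
finite-dimensional subvectors are. -/
def ZonoidEquivalent {T S S' : Type*} [MeasurableSpace S] [MeasurableSpace S']
    (ξ : S → T → ℝ) (ξ' : S' → T → ℝ) (Q : Measure S) (Q' : Measure S') : Prop :=
  ∀ I : Finset T,
    VectorZonoidEquivalent (fun s => I.restrict (ξ s)) (fun s => I.restrict (ξ' s)) Q Q'

/-- Two real processes indexed by `T` have the same finite-dimensional distributions. For finite
`T` (random vectors) this is equality of the laws. -/
def SameDistribution {T Ω Ω' : Type*} [MeasurableSpace Ω] [MeasurableSpace Ω']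
    (X : Ω → T → ℝ) (X' : Ω' → T → ℝ) (P : Measure Ω) (P' : Measure Ω') : Prop :=
  ∀ I : Finset T,
    IdentDistrib (fun ω => I.restrict (X ω)) (fun ω => I.restrict (X' ω)) P P'

/-- A process is symmetric if `ξ` and `-ξ` have the same law. -/
def IsSymmetricProcess {T S : Type*} [MeasurableSpace S] (ξ : S → T → ℝ) (Q : Measure S) : Prop :=
  IdentDistrib ξ (fun s => -ξ s) Q Q

/-- The random ingredients of a LePage series: `ζ 0, ζ 1, …` are i.i.d. standard exponential, and,
independently of them, `ξs 0, ξs 1, …` are i.i.d. copies of the process `ξ`. Path space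
`T → ℝ` carries the product σ-algebra. -/
structure IsLePageInput {T Ω S : Type*} [MeasurableSpace Ω] [MeasurableSpace S]
    (ζ : ℕ → Ω → ℝ) (ξs : ℕ → Ω → T → ℝ) (ξ : S → T → ℝ) (P : Measure Ω) (Q : Measure S) :
    Prop where
  measurable_exp : ∀ k, Measurable (ζ k)
  law_exp : ∀ k, P.map (ζ k) = expMeasure 1
  indep_exp : iIndepFun ζ P
  measurable_copy : ∀ k, Measurable (ξs k)
  measurable_summand : Measurable ξ
  law_copy : ∀ k, IdentDistrib (ξs k) ξ P Q
  indep_copy : iIndepFun ξs P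
  indep_exp_copy : IndepFun (fun ω k => ζ k ω) (fun ω k => ξs k ω) P

/-- The `k`-th LePage term at index `t`, counted from `k = 0`: the copy `ξs k` divided by the
arrival time `ζ 0 + ⋯ + ζ k`. -/
noncomputable def lePageTerm {T Ω : Type*} (ζ : ℕ → Ω → ℝ) (ξs : ℕ → Ω → T → ℝ)
    (k : ℕ) (ω : Ω) (t : T) : ℝ :=
  (∑ i ∈ Finset.range (k + 1), ζ i ω)⁻¹ * ξs k ω t

/-- Partial sums of the LePage series. -/
noncomputable def lePagePartialSum {T Ω : Type*} (ζ : ℕ → Ω → ℝ) (ξs : ℕ → Ω → T → ℝ)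
    (n : ℕ) (ω : Ω) (t : T) : ℝ :=
  ∑ k ∈ Finset.range n, lePageTerm ζ ξs k ω t

/-- The LePage series as the limit of its partial sums; the convergence is conditional in
general, so an unordered sum is not used. -/
noncomputable def lePageSum {T Ω : Type*} (ζ : ℕ → Ω → ℝ) (ξs : ℕ → Ω → T → ℝ)
    (ω : Ω) (t : T) : ℝ :=
  limUnder atTop (fun n => lePagePartialSum ζ ξs n ω t)

/-- The max-analogue of the LePage series. -/
noncomputable def lePageMax {T Ω : Type*} (ζ : ℕ → Ω → ℝ) (ξs : ℕ → Ω → T → ℝ)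
    (ω : Ω) (t : T) : ℝ :=
  ⨆ k, lePageTerm ζ ξs k ω t

/-! The pairs of an arrival time and its mark form a Poisson process on the half-line times the mark
space, with intensity Lebesgue measure times the law `ν` of a mark. Hence, for a kernel `Ψ` bounded
by one in modulus, and under integrability conditions, E ∏ₖ Ψ(Γₖ, mₖ) = exp(-∬ (1 - Ψ(x, y)) dx
dν(y)). This formula is obtained without Poisson theory: with h(x) = ∫ (1 - Ψ(x, y)) dν(y), assumed
real, the product over the first n points times exp(-∫ h over (Γₙ, ∞)) has the same expectation for
all n (`integral_partialProd_mul_survival`). At n = 0 it is the right-hand side; as n → ∞ the second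
factor tends to 1.

Two kernels are used. For Ψ(x, y) = exp(iy/x) and symmetric marks ⟨u, ξ⟩, scaling in x gives the
characteristic function exp(-c E|⟨u, ξ⟩|) of the LePage sum, with c = ∫₀^∞ (1 - cos(1/x)) dx > 0.
Part (i) follows by uniqueness of characteristic functions. Almost sure convergence comes from
fixing the arrival times, which eventually grow at least linearly, and truncating the marks as in
the strong law.

For Ψ(x, y) = 1{y ≤ x} and marks maxᵢ ξᵢ/bᵢ, the formula gives P(Y ≤ b) = exp(-E maxᵢ ξᵢ/bᵢ). So
(ii) reduces to showing that, for nonnegative integrable vectors, the functionals E|⟨u, ξ⟩| and E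
maxᵢ vᵢξᵢ determine each other (`integral_abs_eq_iff_integral_norm_eq`). The link is the law of ξ/ξᵢ
under the density ξᵢ, called `tilt`. These laws, over all i, determine the integral of every
integrable positively homogeneous function. Conversely, either functional determines them: the right
derivative in a of E max(f(ξ), aξᵢ) is E[ξᵢ; f(ξ) ≤ aξᵢ], which for homogeneous f is the tilted mass
of {f ≤ a}. With f linear this gives half-spaces, with f a weighted sup norm it gives boxes. -/

/-! ### Independence of paired sequences and of recursions. -/

section Independence

variable {Ω E : Type*} [MeasurableSpace Ω] [MeasurableSpace E] {P : Measure Ω}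

/-- Measurable rectangles form a generating π-system, and on rectangles the probability factors
first between the two sequences and then within each. -/
theorem iIndepFun_prodMk {ι F : Type*} [Countable ι] [MeasurableSpace F] {X : ι → Ω → E}
    {Y : ι → Ω → F} (hX : ∀ i, Measurable (X i)) (hY : ∀ i, Measurable (Y i))
    (iX : iIndepFun X P) (iY : iIndepFun Y P)
    (hXY : IndepFun (fun ω i => X i ω) (fun ω i => Y i ω) P) :
    iIndepFun (fun i ω => (X i ω, Y i ω)) P := by
  classical
  rw [iIndepFun_iff_iIndep]
  refine iIndepSets.iIndep (fun i => ((hX i).prodMk (hY i)).comap_le)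
    (fun i => {s | ∃ t ∈ Set.image2 (fun (a : Set E) (b : Set F) => a ×ˢ b)
      {s | MeasurableSet s} {t | MeasurableSet t}, (fun ω => (X i ω, Y i ω)) ⁻¹' t = s})
    (fun i => isPiSystem_prod.comap _) (fun i => ?_) ?_
  · conv_lhs => rw [← generateFrom_prod, MeasurableSpace.comap_generateFrom]
    rfl
  · rw [iIndepSets_iff]
    intro s f hf
    have hf' : ∀ i, ∃ A : Set E, ∃ B : Set F, MeasurableSet A ∧ MeasurableSet B ∧
        (i ∈ s → f i = (X i) ⁻¹' A ∩ (Y i) ⁻¹' B) := by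
      intro i
      by_cases his : i ∈ s
      · obtain ⟨_, ⟨A, hA, B, hB, rfl⟩, h⟩ := hf i his
        exact ⟨A, B, hA, hB, fun _ => h ▸ rfl⟩
      · exact ⟨∅, ∅, .empty, .empty, fun h => absurd h his⟩
    choose A B hA hB hAB using hf'
    have e1 : (⋂ i ∈ s, f i) = (⋂ i ∈ s, X i ⁻¹' A i) ∩ (⋂ i ∈ s, Y i ⁻¹' B i) := by
      rw [Set.iInter₂_congr fun i hi => hAB i hi]
      simp only [Set.iInter_inter_distrib]
    have e2 : P ((⋂ i ∈ s, X i ⁻¹' A i) ∩ (⋂ i ∈ s, Y i ⁻¹' B i)) =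
        P (⋂ i ∈ s, X i ⁻¹' A i) * P (⋂ i ∈ s, Y i ⁻¹' B i) := by
      have := hXY.measure_inter_preimage_eq_mul (⋂ i ∈ s, (fun x : ι → E => x i) ⁻¹' A i)
        (⋂ i ∈ s, (fun x : ι → F => x i) ⁻¹' B i)
        (.biInter s.countable_toSet fun i _ => measurable_pi_apply i (hA i))
        (.biInter s.countable_toSet fun i _ => measurable_pi_apply i (hB i))
      simpa [Set.preimage_iInter, ← Set.preimage_comp, Function.comp_def] using this
    rw [e1, e2, iX.measure_inter_preimage_eq_mul s (fun i _ => hA i),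
      iY.measure_inter_preimage_eq_mul s (fun i _ => hB i), ← Finset.prod_mul_distrib]
    refine Finset.prod_congr rfl fun i hi => ?_
    rw [hAB i hi]
    exact ((hXY.comp (measurable_pi_apply i) (measurable_pi_apply i)).measure_inter_preimage_eq_mul
      _ _ (hA i) (hB i)).symm

/-- A process driven by independent innovations is independent of the next innovation. -/
theorem indepFun_recursion {G : Type*} [MeasurableSpace G] {Z : ℕ → Ω → E}
    (hZ : ∀ k, Measurable (Z k)) (iZ : iIndepFun Z P) {W : ℕ → Ω → G} {Φ : G × E → G}
    (hΦ : Measurable Φ) {w : G} (h0 : ∀ ω, W 0 ω = w)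
    (hs : ∀ n ω, W (n + 1) ω = Φ (W n ω, Z n ω)) (n : ℕ) : IndepFun (W n) (Z n) P := by
  have key : ∀ n, Measurable[⨆ i ∈ Set.Iio n, MeasurableSpace.comap (Z i) inferInstance] (W n) := by
    intro n
    induction n with
    | zero =>
      have : W 0 = fun _ => w := funext h0
      rw [this]; exact @measurable_const _ _ _ (_) _
    | succ n ih =>
      have : W (n + 1) = fun ω => Φ (W n ω, Z n ω) := funext (hs n)
      rw [this]
      refine hΦ.comp (Measurable.prodMk ?_ ?_)
      · exact ih.mono (biSup_mono fun i hi => lt_trans hi (Nat.lt_succ_self n)) le_rfl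
      · refine (comap_measurable (Z n)).mono ?_ le_rfl
        exact le_biSup (fun i => MeasurableSpace.comap (Z i) inferInstance) (Nat.lt_succ_self n)
  have hind := indep_iSup_of_disjoint (fun i => (hZ i).comap_le)
    iZ.iIndep (S := Set.Iio n) (T := {n}) (by simp)
  rw [IndepFun_iff_Indep]
  refine indep_of_indep_of_le_left (indep_of_indep_of_le_right hind ?_) (key n).comap_le
  simp

end Independence

/-! ### The invariant function of an exponential jump with killing. -/

section Harmonic

theorem integral_expMeasure_one {E : Type*} [NormedAddCommGroup E] [NormedSpace ℝ E] (f : ℝ → E) :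
    ∫ z, f z ∂(expMeasure 1) = ∫ z in Set.Ioi 0, Real.exp (-z) • f z := by
  have h : expMeasure 1 = volume.withDensity (exponentialPDF 1) := rfl
  rw [h, integral_withDensity_eq_integral_toReal_smul
    (show Measurable (exponentialPDF 1) from (measurable_exponentialPDFReal 1).ennreal_ofReal)
    (ae_of_all _ fun _ => ENNReal.ofReal_lt_top),
    ← integral_Ici_eq_integral_Ioi, ← integral_indicator measurableSet_Ici]
  refine integral_congr_ae (ae_of_all _ fun z => ?_)
  simp only [exponentialPDF_eq, Set.indicator, Set.mem_Ici]
  split_ifs <;> simp [Real.exp_nonneg]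

/-- The bounded function which is invariant under an exponential jump followed by killing with
probability `h`. -/
noncomputable def survival (h : ℝ → ℝ) (s : ℝ) : ℝ :=
  Real.exp ((∫ x in (0 : ℝ)..s, h x) - ∫ x in Set.Ioi 0, h x)

variable {h : ℝ → ℝ}

theorem continuous_survival (hi : Integrable h) : Continuous (survival h) :=
  Real.continuous_exp.comp
    ((intervalIntegral.continuous_primitive (fun _ _ => hi.intervalIntegrable) 0).sub
      continuous_const)

theorem survival_nonneg (s : ℝ) : 0 ≤ survival h s := (Real.exp_pos _).le

theorem survival_le_one (hi : Integrable h) (h0 : ∀ x, 0 ≤ h x) {s : ℝ} (hs : 0 ≤ s) :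
    survival h s ≤ 1 := by
  rw [survival, Real.exp_le_one_iff, sub_nonpos, intervalIntegral.integral_of_le hs]
  exact setIntegral_mono_set hi.integrableOn (ae_of_all _ h0)
    (Set.Ioc_subset_Ioi_self.eventuallyLE)

theorem tendsto_survival (hi : Integrable h) : Tendsto (survival h) atTop (𝓝 1) := by
  have := intervalIntegral_tendsto_integral_Ioi 0 (hi.integrableOn (s := Set.Ioi 0)) tendsto_id
  have := (Real.continuous_exp.tendsto _).comp (this.sub_const (∫ x in Set.Ioi 0, h x))
  rw [sub_self, Real.exp_zero] at this
  exact this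

theorem survival_zero : survival h 0 = Real.exp (-∫ x in Set.Ioi 0, h x) := by
  simp [survival]

theorem hasDerivWithinAt_survival (hi : Integrable h) {x : ℝ}
    (hc : ContinuousWithinAt h (Set.Ioi x) x) :
    HasDerivWithinAt (survival h) (survival h x * h x) (Set.Ioi x) x := by
  have h1 : HasDerivWithinAt (fun s => ∫ y in (0 : ℝ)..s, h y) (h x) (Set.Ici x) x :=
    intervalIntegral.integral_hasDerivWithinAt_right hi.intervalIntegrable
      (hi.aestronglyMeasurable.stronglyMeasurableAtFilter) hc
  exact ((h1.mono Set.Ioi_subset_Ici_self).sub_const _).exp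

/-- The integrand is the right derivative in z of -exp(-z) · `survival h (s + z)`, and the boundary
term at infinity vanishes. One-sided derivatives suffice, so `h` need only be right-continuous; this
admits the discontinuous kernel used for maxima. -/
theorem integral_exp_mul_survival (hi : Integrable h) (hm : Measurable h) (h0 : ∀ x, 0 ≤ h x)
    (h2 : ∀ x, h x ≤ 2) (hc : ∀ x, 0 < x → ContinuousWithinAt h (Set.Ioi x) x) {s : ℝ}
    (hs : 0 ≤ s) :
    ∫ z in Set.Ioi 0, Real.exp (-z) * ((1 - h (s + z)) * survival h (s + z)) = survival h s := by
  have hcont := continuous_survival hi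
  have hint : IntegrableOn (fun z => Real.exp (-z) * ((1 - h (s + z)) * survival h (s + z)))
      (Set.Ioi 0) := by
    refine Integrable.mono' (integrableOn_exp_neg_Ioi 0) ?_ ?_
    · exact Measurable.aestronglyMeasurable (by fun_prop)
    · filter_upwards [ae_restrict_mem measurableSet_Ioi] with z hz
      rw [norm_mul, Real.norm_of_nonneg (Real.exp_nonneg _), norm_mul,
        Real.norm_of_nonneg (survival_nonneg _)]
      refine mul_le_of_le_one_right (Real.exp_nonneg _) (mul_le_one₀ ?_ (survival_nonneg _)
        (survival_le_one hi h0 (add_nonneg hs (le_of_lt hz))))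
      rw [Real.norm_eq_abs, abs_le]
      constructor <;> linarith [h0 (s + z), h2 (s + z)]
  have hlim := intervalIntegral_tendsto_integral_Ioi 0 hint tendsto_id
  have hprim : ∀ b, 0 ≤ b → ∫ z in (0 : ℝ)..b,
      Real.exp (-z) * ((1 - h (s + z)) * survival h (s + z)) =
      survival h s - Real.exp (-b) * survival h (s + b) := by
    intro b hb
    have hd := intervalIntegral.integral_eq_sub_of_hasDeriv_right (a := 0) (b := b)
      (f := fun z => -(Real.exp (-z) * survival h (s + z)))
      (f' := fun z => Real.exp (-z) * ((1 - h (s + z)) * survival h (s + z)))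
      (by fun_prop) ?_ ?_
    · rw [hd]; simp; ring
    · intro x hx
      have hx0 : 0 < x := by simpa [hb] using hx.1
      have e1 : HasDerivWithinAt (fun z => survival h (s + z))
          (survival h (s + x) * h (s + x)) (Set.Ioi x) x := by
        have := (hasDerivWithinAt_survival hi (hc (s + x) (by linarith)))
        have h3 := HasDerivWithinAt.scomp (h := fun z => s + z) (s := Set.Ioi x) x this
          ((hasDerivAt_id x).const_add s).hasDerivWithinAt (fun y hy => by
            simpa using hy)
        simpa [Function.comp_def] using h3
      have e2 : HasDerivWithinAt (fun z => Real.exp (-z)) (-Real.exp (-x)) (Set.Ioi x) x := by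
        simpa using ((hasDerivAt_id x).neg.exp).hasDerivWithinAt
      exact (e2.mul e1).neg.congr_deriv (by ring)
    · rw [intervalIntegrable_iff_integrableOn_Ioc_of_le hb]
      exact hint.mono_set Set.Ioc_subset_Ioi_self
  refine tendsto_nhds_unique hlim ?_
  have : Tendsto (fun b => survival h s - Real.exp (-b) * survival h (s + b)) atTop
      (𝓝 (survival h s - 0 * 1)) :=
    tendsto_const_nhds.sub (Real.tendsto_exp_neg_atTop_nhds_zero.mul
      ((tendsto_survival hi).comp (tendsto_atTop_add_const_left _ s tendsto_id)))
  rw [zero_mul, sub_zero] at this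
  refine this.congr' ?_
  filter_upwards [eventually_ge_atTop 0] with b hb using (hprim b hb).symm

end Harmonic

/-! ### Marked arrivals and the expectation of their products. -/

/-- Independent standard exponential gaps, each carrying an independent mark of law `ν`. -/
structure IsMarkedArrival {Ω E : Type*} [MeasurableSpace Ω] [MeasurableSpace E]
    (ζ : ℕ → Ω → ℝ) (m : ℕ → Ω → E) (P : Measure Ω) (ν : Measure E) : Prop where
  measurable_gap : ∀ k, Measurable (ζ k)
  measurable_mark : ∀ k, Measurable (m k)
  law : ∀ k, P.map (fun ω => (ζ k ω, m k ω)) = (expMeasure 1).prod ν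
  indep : iIndepFun (fun k ω => (ζ k ω, m k ω)) P

/-- Allowing a general `φ` reduces finite-dimensional questions to scalar marks: a coordinate, a
linear form or a weighted norm of the process. -/
theorem IsLePageInput.isMarkedArrival {T Ω S E : Type*} [MeasurableSpace Ω] [MeasurableSpace S]
    [MeasurableSpace E] {ζ : ℕ → Ω → ℝ} {ξs : ℕ → Ω → T → ℝ} {ξ : S → T → ℝ} {P : Measure Ω}
    {Q : Measure S} [IsProbabilityMeasure P] (hL : IsLePageInput ζ ξs ξ P Q) {φ : (T → ℝ) → E}
    (hφ : Measurable φ) :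
    IsMarkedArrival ζ (fun k ω => φ (ξs k ω)) P (Q.map fun s => φ (ξ s)) where
  measurable_gap := hL.measurable_exp
  measurable_mark k := hφ.comp (hL.measurable_copy k)
  law k := by
    have hi : IndepFun (ζ k) (fun ω => φ (ξs k ω)) P :=
      hL.indep_exp_copy.comp (measurable_pi_apply k) (hφ.comp (measurable_pi_apply k))
    have hm : Measurable fun ω => φ (ξs k ω) := hφ.comp (hL.measurable_copy k)
    rw [(indepFun_iff_map_prod_eq_prod_map_map (hL.measurable_exp k).aemeasurable
      hm.aemeasurable).1 hi, hL.law_exp k]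
    congr 1
    exact ((hL.law_copy k).comp hφ).map_eq
  indep :=
    (iIndepFun_prodMk hL.measurable_exp hL.measurable_copy hL.indep_exp hL.indep_copy
      hL.indep_exp_copy).comp (fun _ p => (p.1, φ p.2))
      fun _ => measurable_fst.prodMk (hφ.comp measurable_snd)

theorem Measurable.uncurry_apply {α β γ δ : Type*} [MeasurableSpace α] [MeasurableSpace β]
    [MeasurableSpace γ] [MeasurableSpace δ] {Ψ : α → β → γ} (hΨ : Measurable (Function.uncurry Ψ))
    {f : δ → α} {g : δ → β} (hf : Measurable f) (hg : Measurable g) :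
    Measurable fun d => Ψ (f d) (g d) :=
  hΨ.comp (hf.prodMk hg)

namespace IsMarkedArrival

/-- The multiplicative functional of the marked points, stopped after `n` points. -/
noncomputable def partialProd {Ω E : Type*} (ζ : ℕ → Ω → ℝ) (m : ℕ → Ω → E) (Ψ : ℝ → E → ℂ) (n : ℕ) (ω : Ω) :
    ℂ :=
  ∏ k ∈ Finset.range n, Ψ (∑ i ∈ Finset.range (k + 1), ζ i ω) (m k ω)

theorem norm_partialProd_le {Ω E : Type*} {ζ : ℕ → Ω → ℝ} {m : ℕ → Ω → E} {Ψ : ℝ → E → ℂ} (hb : ∀ x y, ‖Ψ x y‖ ≤ 1) (n : ℕ) (ω : Ω) :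
    ‖partialProd ζ m Ψ n ω‖ ≤ 1 := by
  rw [partialProd, norm_prod]
  exact Finset.prod_le_one (fun _ _ => norm_nonneg _) fun _ _ => hb _ _

variable {Ω E : Type*} [MeasurableSpace Ω] [MeasurableSpace E] {ζ : ℕ → Ω → ℝ} {m : ℕ → Ω → E}
  {P : Measure Ω} {ν : Measure E}

theorem indep_gap (hA : IsMarkedArrival ζ m P ν) : iIndepFun ζ P :=
  hA.indep.comp (fun _ p => p.1) fun _ => measurable_fst

theorem indep_mark (hA : IsMarkedArrival ζ m P ν) : iIndepFun m P :=
  hA.indep.comp (fun _ p => p.2) fun _ => measurable_snd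

variable {Ψ : ℝ → E → ℂ} {h : ℝ → ℝ}

theorem measurable_partialProd (hA : IsMarkedArrival ζ m P ν)
    (hΨ : Measurable (Function.uncurry Ψ)) (n : ℕ) : Measurable (partialProd ζ m Ψ n) :=
  Finset.measurable_prod _ fun k _ =>
    hΨ.uncurry_apply (Finset.measurable_sum _ fun i _ => hA.measurable_gap i) (hA.measurable_mark k)

theorem indepFun_partialProd (hA : IsMarkedArrival ζ m P ν)
    (hΨ : Measurable (Function.uncurry Ψ)) (n : ℕ) :
    IndepFun (fun ω => (partialProd ζ m Ψ n ω, ∑ i ∈ Finset.range n, ζ i ω))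
      (fun ω => (ζ n ω, m n ω)) P := by
  refine indepFun_recursion (fun k => (hA.measurable_gap k).prodMk (hA.measurable_mark k)) hA.indep
    (W := fun n ω => (partialProd ζ m Ψ n ω, ∑ i ∈ Finset.range n, ζ i ω))
    (Φ := fun p : (ℂ × ℝ) × (ℝ × E) => (p.1.1 * Ψ (p.1.2 + p.2.1) p.2.2, p.1.2 + p.2.1))
    ?_ (w := (1, 0)) ?_ ?_ n
  · exact ((measurable_fst.comp measurable_fst).mul (hΨ.uncurry_apply (by fun_prop) (by fun_prop))).prodMk (by fun_prop)
  · intro ω; simp [partialProd]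
  · intro n ω; simp [partialProd, Finset.prod_range_succ, Finset.sum_range_succ]

variable [IsProbabilityMeasure ν]

theorem law_gap (hA : IsMarkedArrival ζ m P ν) (k : ℕ) : P.map (ζ k) = expMeasure 1 := by
  have h := congrArg (Measure.map Prod.fst) (hA.law k)
  rw [Measure.map_map measurable_fst ((hA.measurable_gap k).prodMk (hA.measurable_mark k)),
    Measure.map_fst_prod, measure_univ, one_smul] at h
  exact h

theorem law_mark (hA : IsMarkedArrival ζ m P ν) (k : ℕ) : P.map (m k) = ν := by
  have : IsProbabilityMeasure (expMeasure 1) := isProbabilityMeasure_expMeasure one_pos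
  have h := congrArg (Measure.map Prod.snd) (hA.law k)
  rw [Measure.map_map measurable_snd ((hA.measurable_gap k).prodMk (hA.measurable_mark k)),
    Measure.map_snd_prod, measure_univ, one_smul] at h
  exact h

theorem ae_gap_pos (hA : IsMarkedArrival ζ m P ν) : ∀ᵐ ω ∂P, ∀ k, 0 < ζ k ω := by
  rw [ae_all_iff]
  intro k
  have : ∀ᵐ z ∂(expMeasure 1), 0 < z := by
    have h : expMeasure 1 = volume.withDensity (exponentialPDF 1) := rfl
    rw [h, ae_withDensity_iff
      (show Measurable (exponentialPDF 1) from (measurable_exponentialPDFReal 1).ennreal_ofReal)]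
    filter_upwards [Measure.ae_ne volume (0 : ℝ)] with z hz h1
    by_contra hneg
    exact h1 (exponentialPDF_of_neg (lt_of_le_of_ne (not_lt.1 hneg) hz))
  rw [← hA.law_gap k] at this
  exact ae_of_ae_map (hA.measurable_gap k).aemeasurable this

variable [IsProbabilityMeasure P]

/-- Only a lower bound is needed, so the strong law is applied to the gaps capped at 1, whose
integrability is immediate; half of their positive mean serves as slope. -/
theorem exists_linear_le (hA : IsMarkedArrival ζ m P ν) :
    ∃ c : ℝ, 0 < c ∧ ∀ᵐ ω ∂P, ∀ᶠ n : ℕ in atTop, c * n ≤ ∑ i ∈ Finset.range n, ζ i ω := by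
  have hprob : IsProbabilityMeasure (expMeasure 1) := isProbabilityMeasure_expMeasure one_pos
  set f : ℝ → ℝ := fun z => min z 1 with hf
  have hfm : Measurable f := by fun_prop
  have hbd : ∀ᵐ ω ∂P, ∀ k, 0 < f (ζ k ω) := by
    filter_upwards [hA.ae_gap_pos] with ω h k using lt_min (h k) one_pos
  have hint : Integrable (fun ω => f (ζ 0 ω)) P := by
    refine Integrable.of_bound (C := 1) (hfm.comp (hA.measurable_gap 0)).aestronglyMeasurable ?_
    filter_upwards [hbd] with ω h
    rw [Real.norm_of_nonneg (h 0).le]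
    exact min_le_right _ _
  have hpos : 0 < ∫ ω, f (ζ 0 ω) ∂P := by
    rw [integral_pos_iff_support_of_nonneg_ae (hbd.mono fun ω h => (h 0).le) hint]
    have : (Function.support fun ω => f (ζ 0 ω)) =ᵐ[P] Set.univ := by
      rw [eventuallyEq_univ]
      exact hbd.mono fun ω h => (h 0).ne'
    rw [measure_congr this]; simp
  refine ⟨(∫ ω, f (ζ 0 ω) ∂P) / 2, by positivity, ?_⟩
  have hs := strong_law_ae_real (μ := P) (fun k ω => f (ζ k ω)) hint
    (fun i j hij => (hA.indep_gap.indepFun hij).comp hfm hfm)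
    (fun i => IdentDistrib.comp ⟨(hA.measurable_gap i).aemeasurable,
      (hA.measurable_gap 0).aemeasurable, by rw [hA.law_gap, hA.law_gap]⟩ hfm)
  filter_upwards [hs] with ω hω
  filter_upwards [hω.eventually (eventually_gt_nhds (half_lt_self hpos)), eventually_gt_atTop 0]
    with n hn hn0
  rw [lt_div_iff₀ (by exact_mod_cast hn0)] at hn
  exact hn.le.trans (Finset.sum_le_sum fun i _ => min_le_left _ _)

theorem tendsto_arrival (hA : IsMarkedArrival ζ m P ν) :
    ∀ᵐ ω ∂P, Tendsto (fun n => ∑ i ∈ Finset.range n, ζ i ω) atTop atTop := by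
  obtain ⟨c, hc, h⟩ := hA.exists_linear_le
  filter_upwards [h] with ω hω
  exact tendsto_atTop_mono' _ hω (tendsto_natCast_atTop_atTop.const_mul_atTop hc)

/-- The one-step invariance: average over the mark first, then over the gap. The absolute value
changes nothing at positive times, but makes the bound `survival ≤ 1` available everywhere. -/
theorem integral_jump (hΨ : Measurable (Function.uncurry Ψ)) (hb : ∀ x y, ‖Ψ x y‖ ≤ 1)
    (hm : Measurable h) (hi : Integrable h) (h0 : ∀ x, 0 ≤ h x) (h2 : ∀ x, h x ≤ 2)
    (hc : ∀ x, 0 < x → ContinuousWithinAt h (Set.Ioi x) x)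
    (hΨh : ∀ x, 0 < x → ∫ y, Ψ x y ∂ν = 1 - h x) {s : ℝ} (hs : 0 ≤ s) :
    ∫ p : ℝ × E, Ψ (s + p.1) p.2 * survival h |s + p.1| ∂((expMeasure 1).prod ν) =
      survival h s := by
  have hprob : IsProbabilityMeasure (expMeasure 1) := isProbabilityMeasure_expMeasure one_pos
  have hcont := continuous_survival hi
  rw [integral_prod]
  · simp only [integral_mul_const]
    rw [integral_expMeasure_one, ← integral_exp_mul_survival hi hm h0 h2 hc hs,
      ← integral_complex_ofReal]
    refine setIntegral_congr_fun measurableSet_Ioi fun z hz => ?_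
    have : 0 < s + z := add_pos_of_nonneg_of_pos hs hz
    simp only [hΨh _ this, abs_of_pos this, Complex.real_smul]
    push_cast
    ring
  · refine Integrable.of_bound (C := 1) (Measurable.aestronglyMeasurable ?_)
      (ae_of_all _ fun p => ?_)
    · exact (hΨ.uncurry_apply (by fun_prop) (by fun_prop)).mul (by fun_prop)
    · rw [norm_mul, Complex.norm_real, Real.norm_of_nonneg (survival_nonneg _)]
      exact mul_le_one₀ (hb _ _) (survival_nonneg _) (survival_le_one hi h0 (abs_nonneg _))

/-- The next gap and mark are independent of the current product and arrival time, so integrating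
them out by Fubini removes one factor through `integral_jump`. -/
theorem integral_partialProd_mul_survival (hA : IsMarkedArrival ζ m P ν)
    (hΨ : Measurable (Function.uncurry Ψ))
    (hb : ∀ x y, ‖Ψ x y‖ ≤ 1)
    (hm : Measurable h) (hi : Integrable h) (h0 : ∀ x, 0 ≤ h x) (h2 : ∀ x, h x ≤ 2)
    (hc : ∀ x, 0 < x → ContinuousWithinAt h (Set.Ioi x) x)
    (hΨh : ∀ x, 0 < x → ∫ y, Ψ x y ∂ν = 1 - h x) (n : ℕ) :
    ∫ ω, partialProd ζ m Ψ n ω * survival h |∑ i ∈ Finset.range n, ζ i ω| ∂P = survival h 0 := by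
  have hprob : IsProbabilityMeasure (expMeasure 1) := isProbabilityMeasure_expMeasure one_pos
  have hcont := continuous_survival hi
  induction n with
  | zero => simp [partialProd]
  | succ n ih =>
    rw [← ih]
    have hW : Measurable (fun ω => (partialProd ζ m Ψ n ω, ∑ i ∈ Finset.range n, ζ i ω)) :=
      (hA.measurable_partialProd hΨ n).prodMk (Finset.measurable_sum _ fun i _ => hA.measurable_gap i)
    have hZ : Measurable (fun ω => (ζ n ω, m n ω)) :=
      (hA.measurable_gap n).prodMk (hA.measurable_mark n)
    have hlaw := (indepFun_iff_map_prod_eq_prod_map_map hW.aemeasurable hZ.aemeasurable).1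
      (hA.indepFun_partialProd hΨ n)
    rw [hA.law n] at hlaw
    set G : (ℂ × ℝ) × (ℝ × E) → ℂ := fun p =>
      p.1.1 * (Ψ (p.1.2 + p.2.1) p.2.2 * survival h |p.1.2 + p.2.1|) with hG
    have hGm : Measurable G :=
      (measurable_fst.comp measurable_fst).mul ((hΨ.uncurry_apply (by fun_prop) (by fun_prop)).mul (by fun_prop))
    have e1 : ∀ ω, partialProd ζ m Ψ (n + 1) ω *
        survival h |∑ i ∈ Finset.range (n + 1), ζ i ω| =
        G ((partialProd ζ m Ψ n ω, ∑ i ∈ Finset.range n, ζ i ω), (ζ n ω, m n ω)) := by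
      intro ω
      simp only [hG, partialProd, Finset.prod_range_succ, Finset.sum_range_succ]
      ring
    have hPm : IsProbabilityMeasure
        (P.map fun ω => (partialProd ζ m Ψ n ω, ∑ i ∈ Finset.range n, ζ i ω)) :=
      Measure.isProbabilityMeasure_map hW.aemeasurable
    simp only [e1]
    rw [← integral_map (φ := fun ω => ((partialProd ζ m Ψ n ω, ∑ i ∈ Finset.range n, ζ i ω),
      (ζ n ω, m n ω))) (hW.prodMk hZ).aemeasurable hGm.aestronglyMeasurable, hlaw, integral_prod]
    · rw [integral_map hW.aemeasurable
        (hGm.stronglyMeasurable.integral_prod_right).aestronglyMeasurable]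
      refine integral_congr_ae ?_
      filter_upwards [hA.ae_gap_pos] with ω hω
      have hs : 0 ≤ ∑ i ∈ Finset.range n, ζ i ω := Finset.sum_nonneg fun i _ => (hω i).le
      simp only [hG]
      rw [integral_const_mul, integral_jump hΨ hb hm hi h0 h2 hc hΨh hs, abs_of_nonneg hs]
    · rw [← hlaw, integrable_map_measure hGm.aestronglyMeasurable (hW.prodMk hZ).aemeasurable]
      refine Integrable.of_bound (C := 1) (hGm.comp (hW.prodMk hZ)).aestronglyMeasurable
        (ae_of_all _ fun ω => ?_)
      simp only [Function.comp, ← e1]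
      rw [norm_mul, Complex.norm_real, Real.norm_of_nonneg (survival_nonneg _)]
      exact mul_le_one₀ (norm_partialProd_le hb _ _) (survival_nonneg _)
        (survival_le_one hi h0 (abs_nonneg _))

theorem integral_limit_partialProd (hA : IsMarkedArrival ζ m P ν)
    (hΨ : Measurable (Function.uncurry Ψ)) (hb : ∀ x y, ‖Ψ x y‖ ≤ 1)
    (hm : Measurable h) (hi : Integrable h) (h0 : ∀ x, 0 ≤ h x) (h2 : ∀ x, h x ≤ 2)
    (hc : ∀ x, 0 < x → ContinuousWithinAt h (Set.Ioi x) x)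
    (hΨh : ∀ x, 0 < x → ∫ y, Ψ x y ∂ν = 1 - h x) {R : Ω → ℂ}
    (hR : ∀ᵐ ω ∂P, Tendsto (fun n => partialProd ζ m Ψ n ω) atTop (𝓝 (R ω))) :
    ∫ ω, R ω ∂P = Real.exp (-∫ x in Set.Ioi 0, h x) := by
  have hcont := continuous_survival hi
  have hlim : Tendsto (fun n => ∫ ω, partialProd ζ m Ψ n ω *
      survival h |∑ i ∈ Finset.range n, ζ i ω| ∂P) atTop (𝓝 (∫ ω, R ω ∂P)) := by
    refine tendsto_integral_of_dominated_convergence (fun _ => 1) (fun n => ?_)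
      (integrable_const _) (fun n => ae_of_all _ fun ω => ?_) ?_
    · exact ((hA.measurable_partialProd hΨ n).mul (Complex.measurable_ofReal.comp
        (hcont.measurable.comp (measurable_norm.comp
          (Finset.measurable_sum _ fun i _ => hA.measurable_gap i))))).aestronglyMeasurable
    · rw [norm_mul, Complex.norm_real, Real.norm_of_nonneg (survival_nonneg _)]
      exact mul_le_one₀ (norm_partialProd_le hb _ _) (survival_nonneg _)
        (survival_le_one hi h0 (abs_nonneg _))
    · filter_upwards [hR, hA.tendsto_arrival] with ω h1 h3
      have h4 := (tendsto_survival hi).comp (tendsto_abs_atTop_atTop.comp h3)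
      have h5 := h1.mul ((Complex.continuous_ofReal.tendsto _).comp h4)
      simpa using h5
  simp only [hA.integral_partialProd_mul_survival hΨ hb hm hi h0 h2 hc hΨh] at hlim
  rw [← survival_zero]
  exact tendsto_nhds_unique hlim tendsto_const_nhds

/-- The Laplace functional of the marked Poisson process, in terms of the kernel alone. -/
theorem integral_limit_partialProd' (hA : IsMarkedArrival ζ m P ν)
    (hΨ : Measurable (Function.uncurry Ψ)) (hb : ∀ x y, ‖Ψ x y‖ ≤ 1)
    (hc : ∀ y x, 0 < x → ContinuousWithinAt (fun x => Ψ x y) (Set.Ioi x) x)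
    (him : ∀ x, 0 < x → (∫ y, Ψ x y ∂ν).im = 0) {w : E → ℝ}
    (hint : ∀ y, IntegrableOn (fun x => 1 - (Ψ x y).re) (Set.Ioi 0))
    (hw : ∀ y, ∫ x in Set.Ioi 0, (1 - (Ψ x y).re) = w y) (hwi : Integrable w ν) {R : Ω → ℂ}
    (hR : ∀ᵐ ω ∂P, Tendsto (fun n => partialProd ζ m Ψ n ω) atTop (𝓝 (R ω))) :
    ∫ ω, R ω ∂P = Real.exp (-∫ y, w y ∂ν) := by
  have hre : ∀ x y, 0 ≤ 1 - (Ψ x y).re ∧ 1 - (Ψ x y).re ≤ 2 := by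
    intro x y
    have := abs_le.1 ((Complex.abs_re_le_norm _).trans (hb x y))
    constructor <;> linarith [this.1, this.2]
  have hΨi : ∀ x, Integrable (Ψ x) ν := fun x =>
    .of_bound (C := 1) (hΨ.comp measurable_prodMk_left).aestronglyMeasurable (ae_of_all _ (hb x))
  have hDm : Measurable fun p : ℝ × E => 1 - (Ψ p.1 p.2).re :=
    measurable_const.sub (Complex.measurable_re.comp hΨ)
  have hDi : ∀ x, Integrable (fun y => 1 - (Ψ x y).re) ν := fun x =>
    (integrable_const _).sub (hΨi x).re
  set H : ℝ → ℝ := fun x => ∫ y, (1 - (Ψ x y).re) ∂ν with hH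
  have hHm : Measurable H := hDm.stronglyMeasurable.integral_prod_right.measurable
  have hH0 : ∀ x, 0 ≤ H x := fun x => integral_nonneg fun y => (hre x y).1
  have hH2 : ∀ x, H x ≤ 2 := fun x => by
    have := integral_mono (hDi x) (integrable_const (2 : ℝ)) fun y => (hre x y).2
    simpa using this
  have hprod : Integrable (fun p : ℝ × E => 1 - (Ψ p.1 p.2).re)
      ((volume.restrict (Set.Ioi 0)).prod ν) := by
    rw [integrable_prod_iff' hDm.aestronglyMeasurable]
    refine ⟨ae_of_all _ hint, ?_⟩
    refine hwi.congr (ae_of_all _ fun y => ?_)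
    simp only [← hw y, Real.norm_of_nonneg (hre _ _).1]
  have hHi : IntegrableOn H (Set.Ioi 0) := hprod.integral_prod_left
  have hswap : ∫ x in Set.Ioi 0, H x = ∫ y, w y ∂ν := by
    rw [hH, integral_integral_swap hprod]
    simp only [hw]
  -- `H` is controlled only on the positive half-line, whereas the preceding result asks for
  -- integrability on all of ℝ; it is therefore cut off to zero elsewhere.
  rw [← hswap, ← integral_indicator measurableSet_Ioi]
  have hind : ∫ x, (Set.Ioi 0).indicator H x = ∫ x in Set.Ioi 0, (Set.Ioi 0).indicator H x := by
    rw [setIntegral_indicator measurableSet_Ioi, Set.inter_self, integral_indicator measurableSet_Ioi]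
  rw [hind]
  refine hA.integral_limit_partialProd hΨ hb (hHm.indicator measurableSet_Ioi)
    ((integrable_indicator_iff measurableSet_Ioi).2 hHi)
    (Set.indicator_nonneg fun x _ => hH0 x) (fun x => ?_) (fun x hx => ?_) (fun x hx => ?_) hR
  · exact (Set.indicator_le_self' (fun _ _ => hH0 _) x).trans (hH2 x)
  · have hHc : ContinuousWithinAt H (Set.Ioi x) x := by
      refine tendsto_integral_filter_of_dominated_convergence (fun _ => 2)
        (Eventually.of_forall fun z => (hDi z).aestronglyMeasurable)
        (Eventually.of_forall fun z => ae_of_all _ fun y => ?_) (integrable_const _)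
        (ae_of_all _ fun y => ?_)
      · rw [Real.norm_of_nonneg (hre _ _).1]; exact (hre _ _).2
      · exact tendsto_const_nhds.sub ((Complex.continuous_re.tendsto _).comp (hc y x hx))
    refine hHc.congr (fun z hz => ?_) ?_
    · exact Set.indicator_of_mem (lt_trans hx hz) _
    · exact Set.indicator_of_mem hx _
  · rw [Set.indicator_of_mem (Set.mem_Ioi.2 hx), hH]
    refine Complex.ext ?_ ?_
    · simp only [Complex.sub_re, Complex.one_re, Complex.ofReal_re]
      have h1 : ∫ y, (Ψ x y).re ∂ν = (∫ y, Ψ x y ∂ν).re := integral_re (hΨi x)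
      have h3 : Integrable (fun y => (Ψ x y).re) ν := (hΨi x).re
      rw [integral_sub (integrable_const _) h3, h1]
      simp
    · rw [him x hx]; simp

end IsMarkedArrival

/-! ### Convergence of randomly weighted series with fixed weights. -/

section Series

variable {Ω : Type*} [MeasurableSpace Ω] {P : Measure Ω} [IsProbabilityMeasure P]

theorem exists_tendsto_sum_of_eventually_eq {a b : ℕ → ℝ} (hab : ∀ᶠ k in atTop, a k = b k)
    (hb : ∃ l, Tendsto (fun n => ∑ k ∈ Finset.range n, b k) atTop (𝓝 l)) :
    ∃ l, Tendsto (fun n => ∑ k ∈ Finset.range n, a k) atTop (𝓝 l) := by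
  obtain ⟨N, hN⟩ := eventually_atTop.1 hab
  obtain ⟨l, hl⟩ := hb
  refine ⟨l + ∑ k ∈ Finset.range N, (a k - b k), ?_⟩
  refine (hl.add_const _).congr' ?_
  filter_upwards [eventually_ge_atTop N] with n hn
  have := Finset.eventually_constant_sum (u := fun k => a k - b k)
    (fun k hk => sub_eq_zero.2 (hN k hk)) hn
  rw [← this, Finset.sum_sub_distrib]
  ring

/-- A series of independent centred random variables with summable variances converges. -/
theorem ae_exists_tendsto_sum_of_sum_sq_le {Y : ℕ → Ω → ℝ} (hY : ∀ k, Measurable (Y k))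
    (hL2 : ∀ k, MemLp (Y k) 2 P) (iY : iIndepFun Y P) (h0 : ∀ k, ∫ ω, Y k ω ∂P = 0) {C : ℝ}
    (hC : ∀ n, ∑ k ∈ Finset.range n, ∫ ω, Y k ω ^ 2 ∂P ≤ C) :
    ∀ᵐ ω ∂P, ∃ l, Tendsto (fun n => ∑ k ∈ Finset.range n, Y k ω) atTop (𝓝 l) := by
  have hYs : ∀ k, StronglyMeasurable (Y k) := fun k => (hY k).stronglyMeasurable
  set 𝓕 := Filtration.natural Y hYs
  -- The sum includes the index n, so that `S n` generates no more than the natural filtration at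
  -- time n. It is a martingale bounded in L², hence in L¹ because |x| ≤ 1 + x².
  set S : ℕ → Ω → ℝ := fun n => ∑ k ∈ Finset.range (n + 1), Y k with hS
  have hint : ∀ k, Integrable (Y k) P := fun k => (hL2 k).integrable (by norm_num)
  have hSL2 : ∀ n, MemLp (S n) 2 P := fun n => memLp_finsetSum' _ fun k _ => hL2 k
  have hmart : Martingale S 𝓕 P := by
    refine martingale_of_condExp_sub_eq_zero_nat (fun n => ?_)
      (fun n => (hSL2 n).integrable (by norm_num)) (fun n => ?_)
    · refine Finset.stronglyMeasurable_sum _ fun k hk => ?_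
      exact (Filtration.stronglyAdapted_natural hYs k).mono
        (𝓕.mono (Nat.lt_succ_iff.1 (Finset.mem_range.1 hk)))
    · have : S (n + 1) - S n = Y (n + 1) := by
        simp only [hS, Finset.sum_range_succ _ (n + 1)]
        abel
      rw [this]
      refine (iIndepFun.condExp_natural_ae_eq_of_lt hYs iY (Nat.lt_succ_self n)).trans ?_
      simp only [h0]
      rfl
  have hSsq : ∀ n, ∫ ω, S n ω ^ 2 ∂P ≤ C := by
    intro n
    have hvar : ∀ {Z : Ω → ℝ}, MemLp Z 2 P → ∫ ω, Z ω ∂P = 0 → Var[Z; P] = ∫ ω, Z ω ^ 2 ∂P := by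
      intro Z hZ hz
      rw [variance_eq_sub hZ, hz]
      simp
    have hm : ∫ ω, S n ω ∂P = 0 := by
      simp only [hS, Finset.sum_apply]
      rw [integral_finsetSum _ fun k _ => hint k]
      simp [h0]
    rw [← hvar (hSL2 n) hm, hS, IndepFun.variance_sum (fun k _ => hL2 k)
      (fun i _ j _ hij => iY.indepFun hij)]
    simp only [fun k => hvar (hL2 k) (h0 k)]
    exact hC _
  have hbd : ∀ n, eLpNorm (S n) 1 P ≤ ((1 + C).toNNReal : NNReal) := by
    intro n
    have hi := (hSL2 n).integrable (by norm_num)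
    rw [eLpNorm_one_eq_lintegral_enorm, ← ofReal_integral_norm_eq_lintegral_enorm hi]
    refine ENNReal.ofReal_le_ofReal ?_
    have h1 : ∫ ω, ‖S n ω‖ ∂P ≤ ∫ ω, (1 + S n ω ^ 2) ∂P := by
      refine integral_mono hi.norm ((integrable_const _).add (hSL2 n).integrable_sq) fun ω => ?_
      simp only [Real.norm_eq_abs]
      nlinarith [sq_abs (S n ω), sq_nonneg (|S n ω| - 1), abs_nonneg (S n ω)]
    rw [integral_add (integrable_const _) (hSL2 n).integrable_sq] at h1
    simp only [integral_const, probReal_univ, one_smul] at h1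
    linarith [hSsq n]
  filter_upwards [hmart.submartingale.ae_tendsto_limitProcess hbd] with ω hω
  refine ⟨_, (tendsto_add_atTop_iff_nat 1).1 (hω.congr fun n => ?_)⟩
  simp [hS]

/-- Truncation of a real number to zero outside an interval that is symmetric about zero. -/
noncomputable def cutoff (A x : ℝ) : ℝ := if |x| < A then x else 0

theorem measurable_cutoff (A : ℝ) : Measurable (cutoff A) :=
  Measurable.ite (measurableSet_lt (by fun_prop) measurable_const) measurable_id measurable_const

theorem abs_cutoff_le (A x : ℝ) : |cutoff A x| ≤ |A| := by
  unfold cutoff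
  split_ifs with h
  · exact h.le.trans (le_abs_self A)
  · simp

theorem cutoff_neg (A x : ℝ) : cutoff A (-x) = -cutoff A x := by
  unfold cutoff
  rw [abs_neg]
  split_ifs <;> simp

/-- The variance estimate from the proof of the strong law, applied to |X| and shifted by one index.
-/
theorem sum_integral_cutoff_sq_le {X : Ω → ℝ} (hm : Measurable X) (hX : Integrable X P) (n : ℕ) :
    ∑ k ∈ Finset.range n, (((k : ℝ) + 1) ^ 2)⁻¹ * ∫ ω, cutoff (k + 1) (X ω) ^ 2 ∂P ≤
      2 * ∫ ω, |X ω| ∂P := by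
  let _ : MeasureSpace Ω := ⟨P⟩
  have h := sum_variance_truncation_le (X := fun ω => |X ω|) hX.abs (fun ω => abs_nonneg _) (n + 1)
  rw [Finset.sum_range_succ'] at h
  have h1 : ∀ k : ℕ, ∫ ω, cutoff (k + 1) (X ω) ^ 2 ∂P ≤
      ∫ ω, (truncation (fun ω => |X ω|) ((k + 1 : ℕ) : ℝ) ^ 2) ω := by
    intro k
    have hmeas : AEStronglyMeasurable (fun ω => |X ω|) P := hX.abs.aestronglyMeasurable
    refine integral_mono ?_ ?_ fun ω => ?_
    · refine Integrable.of_bound (C := |(k : ℝ) + 1| ^ 2)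
        (((measurable_cutoff _).comp hm).pow_const 2).aestronglyMeasurable (ae_of_all _ fun ω => ?_)
      rw [norm_pow]
      exact pow_le_pow_left₀ (norm_nonneg _) (abs_cutoff_le _ _) 2
    · exact hmeas.memLp_truncation.integrable_sq
    · simp only [Pi.pow_apply, cutoff]
      split_ifs with hlt
      · rw [truncation_eq_self (by push_cast; rwa [abs_abs]), sq_abs]
      · rw [zero_pow two_ne_zero]
        positivity
  refine le_trans (Finset.sum_le_sum fun k _ => ?_) ((le_add_of_nonneg_right ?_).trans h)
  · push_cast
    exact mul_le_mul_of_nonneg_left (by simpa using h1 k) (by positivity)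
  · simp

variable {X : ℕ → Ω → ℝ}

/-- Truncating the k-th variable at level k + 1 keeps it centred by symmetry and makes the weighted
variances summable; by Borel–Cantelli and integrability, almost surely only finitely many terms are
changed. -/
theorem ae_exists_tendsto_sum_div (hX : ∀ k, Measurable (X k)) (iX : iIndepFun X P)
    (hd : ∀ k, IdentDistrib (X k) (X 0) P P) (hint : Integrable (X 0) P)
    (hs : IdentDistrib (X 0) (fun ω => -X 0 ω) P P) {γ : ℕ → ℝ} {c : ℝ} (hc : 0 < c)
    (hγ : ∀ᶠ k : ℕ in atTop, c * (k + 1) ≤ γ k) :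
    ∀ᵐ ω ∂P, ∃ l, Tendsto (fun n => ∑ k ∈ Finset.range n, (γ k)⁻¹ * X k ω) atTop (𝓝 l) := by
  -- The bound on `γ` holds only eventually; `δ` satisfies it for every k and eventually agrees with
  -- `γ`.
  set δ : ℕ → ℝ := fun k => max (γ k) (c * (k + 1)) with hδ
  have hδpos : ∀ k, 0 < δ k := fun k => lt_max_of_lt_right (by positivity)
  have hconv : ∀ᵐ ω ∂P, ∃ l, Tendsto
      (fun n => ∑ k ∈ Finset.range n, (δ k)⁻¹ * cutoff (k + 1) (X k ω)) atTop (𝓝 l) := by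
    have hcm : ∀ k : ℕ, Measurable fun ω => cutoff ((k : ℝ) + 1) (X k ω) := fun k =>
      (measurable_cutoff _).comp (hX k)
    refine ae_exists_tendsto_sum_of_sum_sq_le (C := (c ^ 2)⁻¹ * (2 * ∫ ω, |X 0 ω| ∂P))
      (fun k => (hcm k).const_mul _) (fun k => ?_) ?_ (fun k => ?_) (fun n => ?_)
    · refine MemLp.const_mul ?_ _
      exact MemLp.of_bound (hcm k).aestronglyMeasurable |(k : ℝ) + 1|
        (ae_of_all _ fun ω => abs_cutoff_le _ _)
    · exact iX.comp (fun k x => (δ k)⁻¹ * cutoff (k + 1) x)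
        fun k => (measurable_cutoff _).const_mul _
    · rw [integral_const_mul]
      have h1 := ((hd k).comp (measurable_cutoff (k + 1))).integral_eq
      have h2 := (hs.comp (measurable_cutoff (k + 1))).integral_eq
      simp only [Function.comp_def, cutoff_neg, integral_neg] at h1 h2
      have h3 : ∫ ω, cutoff (k + 1) (X 0 ω) ∂P = 0 := by linarith
      rw [h1, h3, mul_zero]
    · refine le_trans ?_ (mul_le_mul_of_nonneg_left (sum_integral_cutoff_sq_le (hX 0) hint n)
        (by positivity))
      rw [Finset.mul_sum]
      refine Finset.sum_le_sum fun k _ => ?_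
      simp only [mul_pow]
      rw [integral_const_mul]
      have h1 := ((hd k).comp ((measurable_cutoff (k + 1)).pow_const 2)).integral_eq
      simp only [Function.comp_def] at h1
      rw [h1, ← mul_assoc]
      refine mul_le_mul_of_nonneg_right ?_ (integral_nonneg fun ω => sq_nonneg _)
      rw [← mul_inv, ← mul_pow, inv_pow]
      exact inv_anti₀ (by positivity) (pow_le_pow_left₀ (by positivity) (le_max_right _ _) 2)
  have hcut : ∀ᵐ ω ∂P, ∀ᶠ k : ℕ in atTop, cutoff (k + 1) (X k ω) = X k ω := by
    have hfin : ∑' k : ℕ, P {ω | (k : ℝ) < |X k ω|} ≠ ⊤ := by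
      let _ : MeasureSpace Ω := ⟨P⟩
      have := tsum_prob_mem_Ioi_lt_top (X := fun ω => |X 0 ω|) hint.abs (fun ω => abs_nonneg _)
      have he : ∀ k : ℕ, P {ω | (k : ℝ) < |X k ω|} = P {ω | |X 0 ω| ∈ Set.Ioi (k : ℝ)} := fun k =>
        ((hd k).comp measurable_norm).measure_mem_eq measurableSet_Ioi
      simp only [he]
      exact this.ne
    filter_upwards [ae_eventually_notMem hfin] with ω hω
    filter_upwards [hω] with k hk
    have : |X k ω| < (k : ℝ) + 1 := lt_of_le_of_lt (not_lt.1 hk) (lt_add_one _)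
    simp [cutoff, this]
  filter_upwards [hconv, hcut] with ω h1 h2
  refine exists_tendsto_sum_of_eventually_eq ?_ h1
  filter_upwards [h2, hγ] with k hk hk'
  rw [hk, hδ]
  simp only [max_eq_left hk']

end Series

/-! ### Convergence of the series at random arrival times. -/

namespace IsMarkedArrival

variable {Ω : Type*} [MeasurableSpace Ω] {ζ : ℕ → Ω → ℝ} {m : ℕ → Ω → ℝ}
  {P : Measure Ω} {ν : Measure ℝ} [IsProbabilityMeasure P] [IsProbabilityMeasure ν]

theorem ae_exists_tendsto_sum (hA : IsMarkedArrival ζ m P ν)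
    (hind : IndepFun (fun ω k => ζ k ω) (fun ω k => m k ω) P) (hint : Integrable (fun x => x) ν)
    (hs : ν.map (fun x => -x) = ν) :
    ∀ᵐ ω ∂P, ∃ l, Tendsto
      (fun n => ∑ k ∈ Finset.range n, (∑ i ∈ Finset.range (k + 1), ζ i ω)⁻¹ * m k ω) atTop
      (𝓝 l) := by
  have hmm := hA.measurable_mark
  have hζ : Measurable fun ω k => ζ k ω := measurable_pi_lambda _ hA.measurable_gap
  have hm : Measurable fun ω k => m k ω := measurable_pi_lambda _ hmm
  obtain ⟨A, hset, hmem⟩ : ∃ A : Set ((ℕ → ℝ) × (ℕ → ℝ)), MeasurableSet A ∧ ∀ p, p ∈ A ↔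
      ∃ l, Tendsto (fun n => ∑ k ∈ Finset.range n,
        (∑ i ∈ Finset.range (k + 1), p.1 i)⁻¹ * p.2 k) atTop (𝓝 l) :=
    ⟨_, measurableSet_exists_tendsto fun n => by fun_prop, fun p => Iff.rfl⟩
  have hd : ∀ k, IdentDistrib (m k) (m 0) P P := fun k =>
    ⟨(hmm k).aemeasurable, (hmm 0).aemeasurable, by rw [hA.law_mark, hA.law_mark]⟩
  have hint0 : Integrable (m 0) P := by
    rw [← hA.law_mark 0] at hint
    exact (integrable_map_measure measurable_id.aestronglyMeasurable (hmm 0).aemeasurable).1 hint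
  have hs0 : IdentDistrib (m 0) (fun ω => -m 0 ω) P P := by
    refine ⟨(hmm 0).aemeasurable, (hmm 0).neg.aemeasurable, ?_⟩
    rw [← hA.law_mark 0, Measure.map_map measurable_neg (hmm 0)] at hs
    exact hs.symm
  -- Gaps and marks are independent, so their joint law is a product; by Fubini the gap sequence may
  -- be frozen and the result for fixed weights applied.
  have hprod : ∀ᵐ p ∂((P.map fun ω k => ζ k ω).prod (P.map fun ω k => m k ω)), p ∈ A := by
    have : IsProbabilityMeasure (P.map fun ω k => m k ω) :=
      Measure.isProbabilityMeasure_map hm.aemeasurable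
    refine (Measure.ae_prod_iff_ae_ae (p := (· ∈ A)) hset).2 ((ae_map_iff hζ.aemeasurable ?_).2 ?_)
    · exact measurableSet_eq_fun (measurable_measure_prodMk_left hset.compl) measurable_const
    · obtain ⟨c, hc, h⟩ := hA.exists_linear_le
      filter_upwards [h] with ω hω
      refine (ae_map_iff hm.aemeasurable (measurable_prodMk_left hset)).2 ?_
      simp only [hmem]
      refine ae_exists_tendsto_sum_div hmm hA.indep_mark hd hint0 hs0 hc ?_
      filter_upwards [(tendsto_add_atTop_nat 1).eventually hω] with k hk
      exact_mod_cast hk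
  rw [← (indepFun_iff_map_prod_eq_prod_map_map hζ.aemeasurable hm.aemeasurable).1 hind] at hprod
  simpa only [hmem] using (ae_map_iff (p := (· ∈ A)) (hζ.prodMk hm).aemeasurable hset).1 hprod

end IsMarkedArrival

/-! ### The scaling constant of the characteristic exponent. -/

section CosineConstant

/-- Near zero the integrand is at most 2; beyond 1 it is at most x⁻², since 1 - cos t ≤ t²/2. -/
theorem integrableOn_one_sub_cos_inv :
    IntegrableOn (fun x : ℝ => 1 - Real.cos x⁻¹) (Set.Ioi 0) := by
  have hm : Measurable fun x : ℝ => 1 - Real.cos x⁻¹ := by fun_prop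
  rw [← Set.Ioc_union_Ioi_eq_Ioi (zero_le_one' ℝ), integrableOn_union]
  constructor
  · refine Measure.integrableOn_of_bounded (M := 2) (by simp) hm.aestronglyMeasurable
      (ae_of_all _ fun x => ?_)
    rw [Real.norm_of_nonneg (by linarith [Real.cos_le_one x⁻¹])]
    linarith [Real.neg_one_le_cos x⁻¹]
  · refine Integrable.mono' (integrableOn_Ioi_rpow_of_lt (a := -2) (by norm_num) zero_lt_one)
      hm.aestronglyMeasurable ?_
    filter_upwards [ae_restrict_mem measurableSet_Ioi] with x hx
    have hx0 : (0 : ℝ) < x := zero_lt_one.trans hx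
    rw [Real.norm_of_nonneg (by linarith [Real.cos_le_one x⁻¹]), Real.rpow_neg hx0.le,
      Real.rpow_two, ← inv_pow]
    have := Real.one_sub_sq_div_two_le_cos (x := x⁻¹)
    nlinarith [sq_nonneg x⁻¹]

theorem integral_one_sub_cos_inv_pos : 0 < ∫ x in Set.Ioi (0 : ℝ), (1 - Real.cos x⁻¹) := by
  rw [setIntegral_pos_iff_support_of_nonneg_ae
    (ae_of_all _ fun x => sub_nonneg.2 (Real.cos_le_one _)) integrableOn_one_sub_cos_inv]
  refine lt_of_lt_of_le ?_ (measure_mono (s := Set.Ioo 1 2) ?_)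
  · simp
  · intro x hx
    have hx0 : (0 : ℝ) < x := zero_lt_one.trans hx.1
    refine ⟨?_, hx0⟩
    have h1 : x⁻¹ < 1 := inv_lt_one_of_one_lt₀ hx.1
    have h2 : Real.cos x⁻¹ < Real.cos 0 := Real.cos_lt_cos_of_nonneg_of_le_pi le_rfl
      (by linarith [Real.pi_gt_three]) (by positivity)
    rw [Real.cos_zero] at h2
    exact (sub_pos.2 h2).ne'

theorem cos_inv_mul_abs (x y : ℝ) : Real.cos (x⁻¹ * y) = Real.cos (x⁻¹ * |y|) := by
  rw [← Real.cos_abs, ← Real.cos_abs (x⁻¹ * |y|), abs_mul, abs_mul, abs_abs]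

theorem integrableOn_one_sub_cos_inv_mul (y : ℝ) :
    IntegrableOn (fun x : ℝ => 1 - Real.cos (x⁻¹ * y)) (Set.Ioi 0) := by
  rcases eq_or_ne y 0 with rfl | hy
  · simp
  · have hy' : 0 < |y|⁻¹ := inv_pos.2 (abs_pos.2 hy)
    have h := (integrableOn_Ioi_comp_mul_left_iff (fun x : ℝ => 1 - Real.cos x⁻¹) 0 hy').2
      (by simpa using integrableOn_one_sub_cos_inv)
    refine h.congr_fun (fun x _ => ?_) measurableSet_Ioi
    simp only [mul_inv, inv_inv]
    rw [cos_inv_mul_abs x y, mul_comm]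

theorem integral_one_sub_cos_inv_mul (y : ℝ) : ∫ x in Set.Ioi (0 : ℝ), (1 - Real.cos (x⁻¹ * y)) =
    (∫ x in Set.Ioi (0 : ℝ), (1 - Real.cos x⁻¹)) * |y| := by
  rcases eq_or_ne y 0 with rfl | hy
  · simp
  · have hy' : 0 < |y|⁻¹ := inv_pos.2 (abs_pos.2 hy)
    have h := integral_comp_mul_left_Ioi (fun x : ℝ => 1 - Real.cos x⁻¹) 0 hy'
    rw [mul_zero, inv_inv, smul_eq_mul, mul_comm |y|] at h
    rw [← h]
    refine setIntegral_congr_fun measurableSet_Ioi (fun x _ => ?_)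
    simp only [mul_inv, inv_inv]
    rw [cos_inv_mul_abs x y, mul_comm]

end CosineConstant

/-! ### The two kernels, and decay of the terms. -/

namespace IsMarkedArrival

variable {Ω : Type*} [MeasurableSpace Ω] {ζ : ℕ → Ω → ℝ} {m : ℕ → Ω → ℝ}
  {P : Measure Ω} {ν : Measure ℝ} [IsProbabilityMeasure P] [IsProbabilityMeasure ν]

/-- The characteristic function at `1` of a LePage series with symmetric marks. -/
theorem integral_exp_sum (hA : IsMarkedArrival ζ m P ν) (hint : Integrable (fun x => x) ν)
    (hs : ν.map (fun x => -x) = ν) {X : Ω → ℝ}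
    (hX : ∀ᵐ ω ∂P, Tendsto
      (fun n => ∑ k ∈ Finset.range n, (∑ i ∈ Finset.range (k + 1), ζ i ω)⁻¹ * m k ω) atTop
      (𝓝 (X ω))) :
    ∫ ω, Complex.exp (X ω * Complex.I) ∂P =
      Real.exp (-((∫ x in Set.Ioi (0 : ℝ), (1 - Real.cos x⁻¹)) * ∫ y, |y| ∂ν)) := by
  rw [← integral_const_mul]
  refine hA.integral_limit_partialProd'
    (Ψ := fun x y => Complex.exp ((x⁻¹ * y : ℝ) * Complex.I))
    (w := fun y => (∫ x in Set.Ioi (0 : ℝ), (1 - Real.cos x⁻¹)) * |y|) ?_ ?_ ?_ ?_ ?_ ?_ ?_ ?_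
  · unfold Function.uncurry
    fun_prop
  · intro x y
    exact (Complex.norm_exp_ofReal_mul_I _).le
  · intro y x hx
    refine ContinuousAt.continuousWithinAt ?_
    have : ContinuousAt (fun x : ℝ => x⁻¹) x := continuousAt_inv₀ hx.ne'
    fun_prop
  · intro x hx
    have hi : Integrable (fun y : ℝ => Complex.exp ((x⁻¹ * y : ℝ) * Complex.I)) ν :=
      .of_bound (C := 1) (Measurable.aestronglyMeasurable (by fun_prop))
        (ae_of_all _ fun y => (Complex.norm_exp_ofReal_mul_I _).le)
    have h1 : ∫ y, (Complex.exp ((x⁻¹ * y : ℝ) * Complex.I)).im ∂ν =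
      (∫ y, Complex.exp ((x⁻¹ * y : ℝ) * Complex.I) ∂ν).im := integral_im hi
    rw [← h1]
    simp only [Complex.exp_ofReal_mul_I_im]
    -- The sine is odd and `ν` is symmetric, so the imaginary part equals its own negative.
    have h2 : ∫ y, Real.sin (x⁻¹ * y) ∂(ν.map fun x => -x) = ∫ y, Real.sin (x⁻¹ * -y) ∂ν :=
      integral_map measurable_neg.aemeasurable (Measurable.aestronglyMeasurable (by fun_prop))
    rw [hs] at h2
    simp only [mul_neg, Real.sin_neg, integral_neg] at h2
    linarith
  · intro y
    simp only [Complex.exp_ofReal_mul_I_re]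
    exact integrableOn_one_sub_cos_inv_mul y
  · intro y
    simp only [Complex.exp_ofReal_mul_I_re]
    exact integral_one_sub_cos_inv_mul y
  · exact hint.abs.const_mul _
  · filter_upwards [hX] with ω hω
    have hc : Continuous fun x : ℝ => Complex.exp (x * Complex.I) := by fun_prop
    refine ((hc.tendsto _).comp hω).congr fun n => ?_
    simp only [partialProd, Function.comp, ← Complex.exp_sum, Complex.ofReal_sum, Finset.sum_mul]

/-- The void probability of the marked Poisson process above the diagonal. -/
theorem measureReal_forall_mark_le (hA : IsMarkedArrival ζ m P ν)
    (hint : Integrable (fun x => x) ν) :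
    P.real {ω | ∀ k, m k ω ≤ ∑ i ∈ Finset.range (k + 1), ζ i ω} =
      Real.exp (-∫ y, max y 0 ∂ν) := by
  classical
  set R : Set Ω := {ω | ∀ k, m k ω ≤ ∑ i ∈ Finset.range (k + 1), ζ i ω} with hR
  have hRm : MeasurableSet R := by
    rw [hR, Set.ofPred_forall]
    exact .iInter fun k => measurableSet_le (hA.measurable_mark k)
      (Finset.measurable_sum _ fun i _ => hA.measurable_gap i)
  have hre : ∀ x y : ℝ, (1 - (if y ≤ x then (1 : ℂ) else 0).re) =
      (Set.Iio y).indicator (fun _ => (1 : ℝ)) x := by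
    intro x y
    by_cases h : y ≤ x
    · simp [h]
    · simp [h, not_le.1 h]
  have key : ∫ ω, R.indicator (fun _ => (1 : ℂ)) ω ∂P = Real.exp (-∫ y, max y 0 ∂ν) := by
    refine hA.integral_limit_partialProd' (Ψ := fun x y => if y ≤ x then 1 else 0)
      (w := fun y => max y 0) ?_ ?_ ?_ ?_ ?_ ?_ ?_ ?_
    · exact Measurable.ite (measurableSet_le measurable_snd measurable_fst) measurable_const
        measurable_const
    · intro x y
      split_ifs <;> simp
    · intro y x hx
      by_cases h : y ≤ x
      · refine continuousWithinAt_const.congr (fun z hz => ?_) (if_pos h)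
        exact if_pos (h.trans (le_of_lt hz))
      · refine ContinuousAt.continuousWithinAt (continuousAt_const.congr (f := fun _ => (0 : ℂ)) ?_)
        filter_upwards [eventually_lt_nhds (not_le.1 h)] with z hz
        exact (if_neg (not_le.2 hz)).symm
    · intro x hx
      have : ∀ y : ℝ, (if y ≤ x then (1 : ℂ) else 0) = (((if y ≤ x then 1 else 0 : ℝ)) : ℂ) := by
        intro y
        split_ifs <;> simp
      simp only [this]
      rw [integral_complex_ofReal]
      exact Complex.ofReal_im _
    · intro y
      simp only [hre]
      rw [IntegrableOn, integrable_indicator_iff measurableSet_Iio,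
        IntegrableOn, Measure.restrict_restrict measurableSet_Iio]
      refine integrableOn_const (s := Set.Iio y ∩ Set.Ioi 0) ?_
      rw [Set.inter_comm, Set.Ioi_inter_Iio]
      simp
    · intro y
      simp only [hre]
      rw [integral_indicator measurableSet_Iio, Measure.restrict_restrict measurableSet_Iio,
        Set.inter_comm, Set.Ioi_inter_Iio]
      simp
    · exact hint.pos_part
    -- On `R` every partial product is 1; off `R` one factor is 0, so the products are eventually 0.
    · refine ae_of_all _ fun ω => ?_
      by_cases h : ω ∈ R
      · have : ∀ n, partialProd ζ m (fun x y => if y ≤ x then (1 : ℂ) else 0) n ω = 1 := fun n =>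
          Finset.prod_eq_one fun k _ => if_pos (h k)
        simp [this, h]
      · rw [Set.indicator_of_notMem h]
        simp only [hR, Set.mem_ofPred_eq, not_forall] at h
        obtain ⟨k, hk⟩ := h
        refine tendsto_const_nhds.congr' ?_
        filter_upwards [eventually_gt_atTop k] with n hn
        exact (Finset.prod_eq_zero (Finset.mem_range.2 hn) (if_neg hk)).symm
  rw [integral_indicator_const _ hRm] at key
  exact Complex.ofReal_injective (by simpa using key)

theorem ae_tendsto_inv_arrival_mul (hA : IsMarkedArrival ζ m P ν)
    (hint : Integrable (fun x => x) ν) :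
    ∀ᵐ ω ∂P, Tendsto (fun k => (∑ i ∈ Finset.range (k + 1), ζ i ω)⁻¹ * m k ω) atTop (𝓝 0) := by
  have hmm := hA.measurable_mark
  have hd : ∀ k, IdentDistrib (m k) (m 0) P P := fun k =>
    ⟨(hmm k).aemeasurable, (hmm 0).aemeasurable, by rw [hA.law_mark, hA.law_mark]⟩
  have hint0 : Integrable (m 0) P := by
    rw [← hA.law_mark 0] at hint
    exact (integrable_map_measure measurable_id.aestronglyMeasurable (hmm 0).aemeasurable).1 hint
  obtain ⟨c, hc, hlin⟩ := hA.exists_linear_le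
  filter_upwards [strong_law_ae_real m hint0 (fun i j hij => hA.indep_mark.indepFun hij) hd, hlin]
    with ω h1 h2
  have h3 := h1.comp (tendsto_add_atTop_nat 1)
  have h4 : Tendsto (fun n : ℕ => (n : ℝ) / ((n : ℝ) + 1)) atTop (𝓝 1) :=
    tendsto_natCast_div_add_atTop 1
  -- A single mark is the difference of consecutive partial sums, and the averages of both have the
  -- same limit.
  have h5 : Tendsto (fun n : ℕ => m n ω / ((n : ℝ) + 1)) atTop (𝓝 0) := by
    have := h3.sub (h1.mul h4)
    rw [mul_one, sub_self] at this
    refine this.congr' ?_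
    filter_upwards [eventually_gt_atTop 0] with n hn
    have : (n : ℝ) ≠ 0 := by positivity
    simp only [Function.comp, Finset.sum_range_succ, Nat.cast_add, Nat.cast_one]
    field_simp
    ring
  have h6 : Tendsto (fun n : ℕ => c⁻¹ * |m n ω / ((n : ℝ) + 1)|) atTop (𝓝 0) := by
    simpa using h5.abs.const_mul c⁻¹
  refine squeeze_zero_norm' ?_ h6
  filter_upwards [(tendsto_add_atTop_nat 1).eventually h2] with n hn
  push_cast at hn
  have hpos : 0 < c * ((n : ℝ) + 1) := by positivity
  have hg := hpos.trans_le hn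
  rw [norm_mul, norm_inv, Real.norm_of_nonneg hg.le, Real.norm_eq_abs, abs_div,
    abs_of_pos (show (0 : ℝ) < n + 1 by positivity), div_eq_inv_mul, ← mul_assoc, ← mul_inv]
  exact mul_le_mul_of_nonneg_right (inv_anti₀ hpos hn) (abs_nonneg _)

end IsMarkedArrival

/-- Unless all terms vanish, some positive term exceeds a whole tail, and the supremum is a maximum
over finitely many indices. -/
theorem isGreatest_iSup_of_tendsto_zero {a : ℕ → ℝ} (h0 : ∀ k, 0 ≤ a k)
    (ha : Tendsto a atTop (𝓝 0)) : IsGreatest (Set.range a) (⨆ k, a k) := by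
  have hb : BddAbove (Set.range a) := ha.bddAbove_range
  refine ⟨?_, fun x hx => le_csSup hb hx⟩
  by_cases h : ∀ k, a k = 0
  · exact ⟨0, by simp [h]⟩
  · push Not at h
    obtain ⟨k, hk⟩ := h
    have hpos : 0 < a k := lt_of_le_of_ne (h0 k) hk.symm
    obtain ⟨N, hN⟩ := eventually_atTop.1 (ha.eventually (eventually_lt_nhds hpos))
    obtain ⟨j, hj, hmax⟩ := Finset.exists_max_image (Finset.range (N + k + 1)) a ⟨k, by simp⟩
    refine ⟨j, le_antisymm (le_ciSup hb j) (ciSup_le fun i => ?_)⟩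
    by_cases hi : i < N + k + 1
    · exact hmax i (Finset.mem_range.2 hi)
    · exact (hN i (by omega)).le.trans (hmax k (by simp))

/-! ### Right derivatives of expected maxima. -/

section Derivative

variable {α β : Type*} [MeasurableSpace α] [MeasurableSpace β] {μ : Measure α} {μ' : Measure β}

/-- The right difference quotient of a ↦ max(f, aw) is dominated by w. It equals w where f ≤ aw,
ties included, and is eventually 0 elsewhere. -/
theorem tendsto_integral_max_slope {f w : α → ℝ} (hf : Integrable f μ) (hw : Integrable w μ)
    (hw0 : ∀ᵐ y ∂μ, 0 ≤ w y) (a : ℝ) :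
    Tendsto (fun n : ℕ => ((n : ℝ) + 1) * ((∫ y, max (f y) ((a + 1 / ((n : ℝ) + 1)) * w y) ∂μ) -
      ∫ y, max (f y) (a * w y) ∂μ)) atTop (𝓝 (∫ y, if f y ≤ a * w y then w y else 0 ∂μ)) := by
  have hi : ∀ a : ℝ, Integrable (fun y => max (f y) (a * w y)) μ := fun a => hf.sup (hw.const_mul a)
  have he : ∀ n : ℕ, ((n : ℝ) + 1) * ((∫ y, max (f y) ((a + 1 / ((n : ℝ) + 1)) * w y) ∂μ) -
      ∫ y, max (f y) (a * w y) ∂μ) = ∫ y, ((n : ℝ) + 1) *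
        (max (f y) ((a + 1 / ((n : ℝ) + 1)) * w y) - max (f y) (a * w y)) ∂μ := by
    intro n
    rw [integral_const_mul, integral_sub (hi _) (hi _)]
  simp only [he]
  refine tendsto_integral_of_dominated_convergence w
    (fun n => (((hi _).sub (hi _)).const_mul _).aestronglyMeasurable) hw (fun n => ?_) ?_
  · filter_upwards [hw0] with y hy
    have hn : (0 : ℝ) < (n : ℝ) + 1 := by positivity
    have h1 : (a + 1 / ((n : ℝ) + 1)) * w y = a * w y + w y / ((n : ℝ) + 1) := by ring
    have h2 : 0 ≤ w y / ((n : ℝ) + 1) := by positivity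
    have h3 : max (f y) (a * w y) ≤ max (f y) (a * w y + w y / ((n : ℝ) + 1)) :=
      max_le_max le_rfl (by linarith)
    have h4 : max (f y) (a * w y + w y / ((n : ℝ) + 1)) ≤
        max (f y) (a * w y) + w y / ((n : ℝ) + 1) :=
      max_le (by linarith [le_max_left (f y) (a * w y)])
        (by linarith [le_max_right (f y) (a * w y)])
    rw [h1, Real.norm_of_nonneg (mul_nonneg hn.le (sub_nonneg.2 h3))]
    calc _ ≤ ((n : ℝ) + 1) * (w y / ((n : ℝ) + 1)) :=
          mul_le_mul_of_nonneg_left (by linarith) hn.le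
      _ = w y := by field_simp
  · filter_upwards [hw0] with y hy
    split_ifs with h
    · refine tendsto_const_nhds.congr fun n => ?_
      have hn : (0 : ℝ) < (n : ℝ) + 1 := by positivity
      have h1 : (a + 1 / ((n : ℝ) + 1)) * w y = a * w y + w y / ((n : ℝ) + 1) := by ring
      have h2 : 0 ≤ w y / ((n : ℝ) + 1) := by positivity
      rw [h1, max_eq_right h, max_eq_right (by linarith)]
      field_simp
      ring
    · have ht : Tendsto (fun n : ℕ => (a + 1 / ((n : ℝ) + 1)) * w y) atTop (𝓝 (a * w y)) := by
        have := (tendsto_one_div_add_atTop_nhds_zero_nat (𝕜 := ℝ)).const_add a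
        simpa using this.mul_const (w y)
      refine tendsto_const_nhds.congr' ?_
      filter_upwards [ht.eventually (eventually_lt_nhds (not_le.1 h))] with n hn
      rw [max_eq_left hn.le, max_eq_left (not_le.1 h).le]
      simp

theorem integral_ite_eq_of_integral_max_eq {f w : α → ℝ} {f' w' : β → ℝ} (hf : Integrable f μ)
    (hw : Integrable w μ) (hw0 : ∀ᵐ y ∂μ, 0 ≤ w y) (hf' : Integrable f' μ')
    (hw' : Integrable w' μ') (hw0' : ∀ᵐ y ∂μ', 0 ≤ w' y) {a : ℝ}
    (h : ∀ b, a ≤ b → ∫ y, max (f y) (b * w y) ∂μ = ∫ y, max (f' y) (b * w' y) ∂μ') :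
    (∫ y, if f y ≤ a * w y then w y else 0 ∂μ) = ∫ y, if f' y ≤ a * w' y then w' y else 0 ∂μ' := by
  refine tendsto_nhds_unique (tendsto_integral_max_slope hf hw hw0 a)
    ((tendsto_integral_max_slope hf' hw' hw0' a).congr fun n => ?_)
  rw [h a le_rfl, h _ (le_add_of_nonneg_right (by positivity))]

end Derivative

/-! ### Boxes determine finite measures. -/

section Boxes

variable {ι : Type*} [Finite ι]

theorem generateFrom_range_Iic_pi :
    (MeasurableSpace.pi : MeasurableSpace (ι → ℝ)) =
      MeasurableSpace.generateFrom (Set.range (Set.Iic : (ι → ℝ) → Set (ι → ℝ))) := by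
  classical
  have := Fintype.ofFinite ι
  refine le_antisymm (iSup_le fun i => ?_)
    (MeasurableSpace.generateFrom_le (by rintro _ ⟨b, rfl⟩; exact measurableSet_Iic))
  rw [show MeasurableSpace.comap (fun y : ι → ℝ => y i) Real.measurableSpace =
    MeasurableSpace.comap (fun y : ι → ℝ => y i) (borel ℝ) by rw [BorelSpace.measurable_eq (α := ℝ)],
    borel_eq_generateFrom_Iic, MeasurableSpace.comap_generateFrom]
  refine MeasurableSpace.generateFrom_le ?_
  rintro _ ⟨_, ⟨a, rfl⟩, rfl⟩
  have : (fun y : ι → ℝ => y i) ⁻¹' Set.Iic a =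
      ⋃ n : ℕ, Set.Iic (Function.update (fun _ => (n : ℝ)) i a) := by
    ext y
    simp only [Set.mem_preimage, Set.mem_Iic, Set.mem_iUnion, le_update_iff]
    constructor
    · intro h
      obtain ⟨n, hn⟩ := exists_nat_ge ‖y‖
      exact ⟨n, h, fun j _ => (Real.le_norm_self _).trans ((norm_le_pi_norm y j).trans hn)⟩
    · rintro ⟨_, h, _⟩
      exact h
  rw [this]
  exact .iUnion fun n => MeasurableSpace.measurableSet_generateFrom ⟨_, rfl⟩

theorem measure_ext_of_Iic_pi {μ μ' : Measure (ι → ℝ)} [IsFiniteMeasure μ]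
    (h : ∀ b, μ (Set.Iic b) = μ' (Set.Iic b)) : μ = μ' := by
  have := Fintype.ofFinite ι
  refine Measure.ext_of_generateFrom_of_iUnion _ (fun n : ℕ => Set.Iic (fun _ => (n : ℝ)))
    generateFrom_range_Iic_pi ?_ ?_ (fun n => ⟨_, rfl⟩) (fun n => measure_ne_top _ _) ?_
  · rintro _ ⟨a, rfl⟩ _ ⟨b, rfl⟩ _
    exact ⟨a ⊓ b, Set.Iic_inter_Iic.symm⟩
  · refine Set.eq_univ_of_forall fun y => Set.mem_iUnion.2 ?_
    obtain ⟨n, hn⟩ := exists_nat_ge ‖y‖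
    exact ⟨n, fun j => (Real.le_norm_self _).trans ((norm_le_pi_norm y j).trans hn)⟩
  · rintro _ ⟨b, rfl⟩
    exact h b

/-- Laws on the nonnegative orthant are determined by their values on boxes with positive upper
corner. -/
theorem measure_ext_of_Iic_pos {μ μ' : Measure (ι → ℝ)} [IsFiniteMeasure μ] [IsFiniteMeasure μ']
    (h0 : ∀ᵐ y ∂μ, 0 ≤ y) (h0' : ∀ᵐ y ∂μ', 0 ≤ y)
    (h : ∀ b : ι → ℝ, (∀ i, 0 < b i) → μ (Set.Iic b) = μ' (Set.Iic b)) : μ = μ' := by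
  refine measure_ext_of_Iic_pi fun b => ?_
  by_cases hb : 0 ≤ b
  -- A corner with zero coordinates is approached from above by positive corners; a corner with a
  -- negative coordinate gives a null box.
  · set c : ℕ → ι → ℝ := fun n i => b i + 1 / ((n : ℝ) + 1) with hc
    have hcb : Set.Iic b = ⋂ n, Set.Iic (c n) := by
      ext y
      simp only [Set.mem_Iic, Set.mem_iInter]
      constructor
      · intro hy n i
        exact (hy i).trans (le_add_of_nonneg_right (by positivity))
      · intro hy i
        refine ge_of_tendsto' (x := atTop) (f := fun n : ℕ => c n i) ?_ fun n => hy n i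
        simpa [hc] using (tendsto_one_div_add_atTop_nhds_zero_nat (𝕜 := ℝ)).const_add (b i)
    have hanti : Antitone fun n => Set.Iic (c n) := fun n k hnk =>
      Set.Iic_subset_Iic.2 fun i => by
        simp only [hc]
        gcongr
    have ht : ∀ ρ : Measure (ι → ℝ), IsFiniteMeasure ρ →
        Tendsto (fun n => ρ (Set.Iic (c n))) atTop (𝓝 (ρ (Set.Iic b))) := by
      intro ρ hρ
      rw [hcb]
      exact tendsto_measure_iInter_atTop (fun n => measurableSet_Iic.nullMeasurableSet) hanti
        ⟨0, measure_ne_top _ _⟩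
    refine tendsto_nhds_unique (ht μ inferInstance) ((ht μ' inferInstance).congr fun n => ?_)
    refine (h _ fun i => ?_).symm
    exact add_pos_of_nonneg_of_pos (hb i) (by positivity)
  · have hz : ∀ ρ : Measure (ι → ℝ), (∀ᵐ y ∂ρ, 0 ≤ y) → ρ (Set.Iic b) = 0 := by
      intro ρ hρ
      refine measure_mono_null (fun y hy hy0 => hb (le_trans hy0 hy)) hρ
    rw [hz μ h0, hz μ' h0']

end Boxes

/-! ### Tilted laws and homogeneous functionals of nonnegative vectors. -/

section Tilt

variable {ι : Type*}

/-- The law of `y / y i` under the measure with density `y i`. -/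
noncomputable def tilt (μ : Measure (ι → ℝ)) (i : ι) : Measure (ι → ℝ) :=
  (μ.withDensity fun y => ENNReal.ofReal (y i)).map fun y => (y i)⁻¹ • y

variable {μ μ' : Measure (ι → ℝ)}

theorem isFiniteMeasure_tilt (hi : ∀ i, Integrable (fun y => y i) μ) (i : ι) :
    IsFiniteMeasure (tilt μ i) := by
  have := isFiniteMeasure_withDensity_ofReal (hi i).2
  unfold tilt
  infer_instance

variable [Fintype ι]

theorem measurable_inv_smul_self (i : ι) : Measurable fun y : ι → ℝ => (y i)⁻¹ • y := by
  fun_prop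

theorem integral_tilt (h0 : ∀ᵐ y ∂μ, 0 ≤ y) (i : ι) {g : (ι → ℝ) → ℝ} (hg : Measurable g) :
    ∫ z, g z ∂(tilt μ i) = ∫ y, y i * g ((y i)⁻¹ • y) ∂μ := by
  rw [tilt, integral_map (measurable_inv_smul_self i).aemeasurable hg.aestronglyMeasurable,
    integral_withDensity_eq_integral_toReal_smul (by fun_prop)
      (ae_of_all _ fun _ => ENNReal.ofReal_lt_top)]
  refine integral_congr_ae ?_
  filter_upwards [h0] with y hy
  rw [ENNReal.toReal_ofReal (hy i), smul_eq_mul]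

/-- Points with y i = 0 carry no tilted mass and contribute zero to the right-hand side, so `p` need
match `s` only where y i > 0. -/
theorem tilt_real_eq (h0 : ∀ᵐ y ∂μ, 0 ≤ y) (i : ι) {s : Set (ι → ℝ)} (hs : MeasurableSet s)
    {p : (ι → ℝ) → Prop} [DecidablePred p]
    (hp : ∀ y, 0 ≤ y → 0 < y i → ((y i)⁻¹ • y ∈ s ↔ p y)) :
    (tilt μ i).real s = ∫ y, if p y then y i else 0 ∂μ := by
  have h := integral_tilt h0 i (g := s.indicator fun _ => 1) (measurable_const.indicator hs)
  rw [integral_indicator_const _ hs, smul_eq_mul, mul_one] at h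
  rw [h]
  refine integral_congr_ae ?_
  filter_upwards [h0] with y hy
  rcases (hy i).eq_or_lt with hz | hpos
  · simp only [Pi.zero_apply] at hz
    simp [← hz]
  · have := hp y hy hpos
    by_cases hy' : p y
    · simp [hy', this.2 hy']
    · have h2 : (y i)⁻¹ • y ∉ s := fun h => hy' (this.1 h)
      simp [hy', h2]

theorem ae_tilt (h0 : ∀ᵐ y ∂μ, 0 ≤ y) (i : ι) : ∀ᵐ z ∂(tilt μ i), 0 ≤ z ∧ z i = 1 := by
  have hs : MeasurableSet {z : ι → ℝ | 0 ≤ z ∧ z i = 1} :=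
    measurableSet_Ici.inter (measurableSet_eq_fun (by fun_prop) (by fun_prop))
  rw [tilt, ae_map_iff (measurable_inv_smul_self i).aemeasurable hs,
    ae_withDensity_iff (by fun_prop)]
  filter_upwards [h0] with y hy hne
  have hpos : 0 < y i := by simpa using hne
  exact ⟨smul_nonneg (inv_nonneg.2 (hy i)) hy, by simp [hpos.ne']⟩

/-- The tilted laws determine integrals of positively homogeneous functions. -/
theorem integral_eq_of_tilt_eq (h0 : ∀ᵐ y ∂μ, 0 ≤ y) (h0' : ∀ᵐ y ∂μ', 0 ≤ y)
    (ht : ∀ i, tilt μ i = tilt μ' i) {f : (ι → ℝ) → ℝ} (hf : Measurable f)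
    (hhom : ∀ c : ℝ, 0 ≤ c → ∀ y, f (c • y) = c * f y) (hi : Integrable f μ)
    (hi' : Integrable f μ') : ∫ y, f y ∂μ = ∫ y, f y ∂μ' := by
  -- `g` is homogeneous of degree zero off the origin, so its i-th tilted integral is that of y i ·
  -- g(y). Summing over i restores f; at the origin f vanishes by homogeneity.
  set g : (ι → ℝ) → ℝ := fun y => f y / ∑ j, y j with hg
  have hgm : Measurable g := hf.div (by fun_prop)
  have key : ∀ ρ : Measure (ι → ℝ), (∀ᵐ y ∂ρ, 0 ≤ y) → Integrable f ρ →
      ∫ y, f y ∂ρ = ∑ i, ∫ z, g z ∂(tilt ρ i) := by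
    intro ρ hρ hfρ
    have e1 : ∀ i, ∫ z, g z ∂(tilt ρ i) = ∫ y, y i * g y ∂ρ := by
      intro i
      rw [integral_tilt hρ i hgm]
      refine integral_congr_ae ?_
      filter_upwards [hρ] with y hy
      rcases (hy i).eq_or_lt with hz | hpos
      · simp only [Pi.zero_apply] at hz
        simp [← hz]
      · have hc : (0 : ℝ) < (y i)⁻¹ := inv_pos.2 hpos
        congr 1
        simp only [hg, hhom _ hc.le, Pi.smul_apply, smul_eq_mul, ← Finset.mul_sum]
        exact mul_div_mul_left _ _ hc.ne'
    simp only [e1]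
    rw [← integral_finsetSum]
    · refine integral_congr_ae ?_
      filter_upwards [hρ] with y hy
      rw [← Finset.sum_mul]
      by_cases hs : ∑ j, y j = 0
      · have : y = 0 := by
          funext j
          exact (Finset.sum_eq_zero_iff_of_nonneg fun j _ => hy j).1 hs j (Finset.mem_univ j)
        have hf0 := hhom 0 le_rfl 0
        simp only [zero_smul, zero_mul] at hf0
        simp [this, hf0]
      · simp only [hg]
        field_simp
    · intro i _
      refine hfρ.mono (Measurable.aestronglyMeasurable ((measurable_pi_apply i).mul hgm)) ?_
      filter_upwards [hρ] with y hy
      have hle : y i ≤ ∑ j, y j := Finset.single_le_sum (fun j _ => hy j) (Finset.mem_univ i)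
      have hsum : 0 ≤ ∑ j, y j := Finset.sum_nonneg fun j _ => hy j
      have h1 : y i * g y = (y i / ∑ j, y j) * f y := by
        simp only [hg]
        ring
      rw [h1, norm_mul, Real.norm_of_nonneg (div_nonneg (hy i) hsum)]
      exact mul_le_of_le_one_left (norm_nonneg _) (div_le_one_of_le₀ hle hsum)
  rw [key μ h0 hi, key μ' h0' hi']
  simp only [ht]

theorem ContinuousLinearMap.exists_eq_sum_mul (L : (ι → ℝ) →L[ℝ] ℝ) :
    ∃ u : ι → ℝ, ∀ z, L z = ∑ j, u j * z j := by
  classical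
  refine ⟨fun j => L (Pi.single j 1), fun z => ?_⟩
  conv_lhs => rw [pi_eq_sum_univ' z, map_sum]
  refine Finset.sum_congr rfl fun j _ => ?_
  rw [map_smul, smul_eq_mul, mul_comm]

/-- Since max(p, q) = (p + q + |p - q|)/2, the hypothesis fixes the expected maxima of ⟨u, y⟩ and a
· y i, and their right derivatives in a give the tilted mass of every half-space. The Cramér–Wold
device concludes. -/
theorem tilt_eq_of_integral_abs_eq (h0 : ∀ᵐ y ∂μ, 0 ≤ y) (h0' : ∀ᵐ y ∂μ', 0 ≤ y)
    (hi : ∀ i, Integrable (fun y => y i) μ) (hi' : ∀ i, Integrable (fun y => y i) μ')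
    (h : ∀ u : ι → ℝ, ∫ y, |∑ i, u i * y i| ∂μ = ∫ y, |∑ i, u i * y i| ∂μ') (i : ι) :
    tilt μ i = tilt μ' i := by
  classical
  have hfin := isFiniteMeasure_tilt hi i
  have hfin' := isFiniteMeasure_tilt hi' i
  have hcoord : ∀ j, ∫ y, y j ∂μ = ∫ y, y j ∂μ' := by
    intro j
    -- On the nonnegative orthant a coordinate is its own absolute value, so the hypothesis also
    -- fixes the means.
    have hj := h (Pi.single j 1)
    simp only [Pi.single_apply, ite_mul, one_mul, zero_mul, Finset.sum_ite_eq', Finset.mem_univ,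
      if_true] at hj
    rw [integral_congr_ae (h0.mono fun y hy => (abs_of_nonneg (hy j)).symm), hj]
    exact integral_congr_ae (h0'.mono fun y hy => abs_of_nonneg (hy j))
  have hlin : ∀ (ρ : Measure (ι → ℝ)), (∀ i, Integrable (fun y => y i) ρ) → ∀ u : ι → ℝ,
      Integrable (fun y => ∑ j, u j * y j) ρ := fun ρ hρ u =>
    integrable_finsetSum _ fun j _ => (hρ j).const_mul _
  have hmax : ∀ (u : ι → ℝ) (a : ℝ),
      ∫ y, max (∑ j, u j * y j) (a * y i) ∂μ = ∫ y, max (∑ j, u j * y j) (a * y i) ∂μ' := by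
    intro u a
    have key : ∀ (ρ : Measure (ι → ℝ)), (∀ i, Integrable (fun y => y i) ρ) →
        ∫ y, max (∑ j, u j * y j) (a * y i) ∂ρ =
          (∑ j, u j * ∫ y, y j ∂ρ + a * ∫ y, y i ∂ρ +
            ∫ y, |∑ j, (u j - if j = i then a else 0) * y j| ∂ρ) / 2 := by
      intro ρ hρ
      have hp : ∀ y : ι → ℝ, max (∑ j, u j * y j) (a * y i) = (∑ j, u j * y j + a * y i +
          |∑ j, (u j - if j = i then a else 0) * y j|) / 2 := by
        intro y
        have : ∑ j, (u j - if j = i then a else 0) * y j = ∑ j, u j * y j - a * y i := by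
          simp [sub_mul, Finset.sum_sub_distrib]
        rw [this]
        rcases le_total (∑ j, u j * y j) (a * y i) with h | h
        · rw [max_eq_right h, abs_of_nonpos (by linarith)]; ring
        · rw [max_eq_left h, abs_of_nonneg (by linarith)]; ring
      simp only [hp]
      rw [integral_div, integral_add _ (hlin ρ hρ _).abs,
        integral_add (hlin ρ hρ _) ((hρ i).const_mul _), integral_const_mul,
        integral_finsetSum _ fun j _ => (hρ j).const_mul _]
      · simp only [integral_const_mul]
      · exact (hlin ρ hρ _).add ((hρ i).const_mul _)
    rw [key μ hi, key μ' hi', h]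
    simp only [hcoord]
  have hmap : ∀ u : ι → ℝ, (tilt μ i).map (fun z => ∑ j, u j * z j) =
      (tilt μ' i).map (fun z => ∑ j, u j * z j) := by
    intro u
    have hum : Measurable fun z : ι → ℝ => ∑ j, u j * z j := by fun_prop
    refine Measure.ext_of_Iic _ _ fun a => ?_
    rw [Measure.map_apply hum measurableSet_Iic, Measure.map_apply hum measurableSet_Iic,
      ← ENNReal.toReal_eq_toReal_iff' (measure_ne_top _ _) (measure_ne_top _ _)]
    have hp : ∀ y : ι → ℝ, 0 ≤ y → 0 < y i →
        ((y i)⁻¹ • y ∈ (fun z : ι → ℝ => ∑ j, u j * z j) ⁻¹' Set.Iic a ↔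
          ∑ j, u j * y j ≤ a * y i) := by
      intro y _ hpos
      have : ∑ j, u j * ((y i)⁻¹ • y) j = (∑ j, u j * y j) / y i := by
        simp only [Pi.smul_apply, smul_eq_mul, Finset.sum_div]
        exact Finset.sum_congr rfl fun j _ => by ring
      rw [Set.mem_preimage, Set.mem_Iic, this, div_le_iff₀ hpos]
    have e := tilt_real_eq h0 i (hum measurableSet_Iic) hp
    have e' := tilt_real_eq h0' i (hum measurableSet_Iic) hp
    simp only [Measure.real] at e e'
    rw [e, e']
    exact integral_ite_eq_of_integral_max_eq (hlin μ hi u) (hi i) (h0.mono fun y hy => hy i)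
      (hlin μ' hi' u) (hi' i) (h0'.mono fun y hy => hy i) fun b _ => hmax u b
  refine Measure.ext_of_charFunDual (funext fun L => ?_)
  obtain ⟨u, hu⟩ := L.exists_eq_sum_mul
  have hLf : (fun z => L z) = fun z => ∑ j, u j * z j := funext hu
  rw [charFunDual_eq_charFun_map_one, charFunDual_eq_charFun_map_one]
  show charFun ((tilt μ i).map fun z => L z) 1 = charFun ((tilt μ' i).map fun z => L z) 1
  rw [hLf, hmap]

/-- The norm is the sup norm, so ‖v * y‖ is maxⱼ vⱼyⱼ on the orthant. The tilted mass of the box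
below b is the right derivative at a = 1 of the expected maximum of ‖b⁻¹ * y‖ and a · y i. If b i <
1 the box is null, because tilted laws live on z i = 1. -/
theorem tilt_eq_of_integral_norm_eq (h0 : ∀ᵐ y ∂μ, 0 ≤ y) (h0' : ∀ᵐ y ∂μ', 0 ≤ y)
    (hi : ∀ i, Integrable (fun y => y i) μ) (hi' : ∀ i, Integrable (fun y => y i) μ')
    (h : ∀ v : ι → ℝ, (∀ i, 0 < v i) → ∫ y, ‖v * y‖ ∂μ = ∫ y, ‖v * y‖ ∂μ') (i : ι) :
    tilt μ i = tilt μ' i := by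
  classical
  have hfin := isFiniteMeasure_tilt hi i
  have hfin' := isFiniteMeasure_tilt hi' i
  refine measure_ext_of_Iic_pos ((ae_tilt h0 i).mono fun z hz => hz.1)
    ((ae_tilt h0' i).mono fun z hz => hz.1) fun b hb => ?_
  by_cases hbi : 1 ≤ b i
  · rw [← ENNReal.toReal_eq_toReal_iff' (measure_ne_top _ _) (measure_ne_top _ _)]
    have hp : ∀ y : ι → ℝ, 0 ≤ y → 0 < y i →
        ((y i)⁻¹ • y ∈ Set.Iic b ↔ ‖b⁻¹ * y‖ ≤ 1 * y i) := by
      intro y hy hpos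
      rw [one_mul, pi_norm_le_iff_of_nonneg hpos.le, Set.mem_Iic, Pi.le_def]
      refine forall_congr' fun j => ?_
      rw [Pi.smul_apply, smul_eq_mul, Pi.mul_apply, Pi.inv_apply, Real.norm_of_nonneg
        (mul_nonneg (inv_nonneg.2 (hb j).le) (hy j)), inv_mul_le_iff₀ hpos, inv_mul_le_iff₀ (hb j),
        mul_comm]
    have e := tilt_real_eq h0 i measurableSet_Iic hp
    have e' := tilt_real_eq h0' i measurableSet_Iic hp
    simp only [Measure.real] at e e'
    rw [e, e']
    have hnorm : ∀ (ρ : Measure (ι → ℝ)), (∀ i, Integrable (fun y => y i) ρ) →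
        Integrable (fun y => ‖b⁻¹ * y‖) ρ := by
      intro ρ hρ
      refine Integrable.norm (Integrable.of_eval fun j => ?_)
      exact (hρ j).const_mul _
    refine integral_ite_eq_of_integral_max_eq (hnorm μ hi) (hi i) (h0.mono fun y hy => hy i)
      (hnorm μ' hi') (hi' i) (h0'.mono fun y hy => hy i) fun a ha => ?_
    have ha0 : 0 < a := one_pos.trans_le ha
    -- As (b i)⁻¹ ≤ 1 ≤ a, taking the maximum with a · y i merely raises the i-th weight to a, and
    -- the result is again a weighted sup norm.
    have hmax : ∀ y : ι → ℝ, 0 ≤ y →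
        max ‖b⁻¹ * y‖ (a * y i) = ‖Function.update b⁻¹ i a * y‖ := by
      intro y hy
      have hba : (b i)⁻¹ ≤ a := (inv_le_one_of_one_le₀ hbi).trans ha
      have hu : ∀ j, (b j)⁻¹ ≤ Function.update b⁻¹ i a j := by
        intro j
        by_cases hj : j = i
        · subst hj; simpa using hba
        · simp [hj]
      refine le_antisymm (max_le ?_ ?_) ?_
      · refine (pi_norm_le_iff_of_nonneg (norm_nonneg _)).2 fun j => ?_
        refine le_trans ?_ (norm_le_pi_norm (Function.update b⁻¹ i a * y) j)
        have hbj := inv_nonneg.2 (hb j).le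
        rw [Pi.mul_apply, Pi.mul_apply, Pi.inv_apply, Real.norm_of_nonneg (mul_nonneg hbj (hy j)),
          Real.norm_of_nonneg (mul_nonneg (hbj.trans (hu j)) (hy j))]
        exact mul_le_mul_of_nonneg_right (hu j) (hy j)
      · refine le_trans ?_ (norm_le_pi_norm (Function.update b⁻¹ i a * y) i)
        simpa using le_abs_self (a * y i)
      · refine (pi_norm_le_iff_of_nonneg (le_max_of_le_left (norm_nonneg _))).2 fun j => ?_
        by_cases hj : j = i
        · subst hj
          refine le_max_of_le_right ?_
          rw [Pi.mul_apply, Function.update_self, Real.norm_of_nonneg (mul_nonneg ha0.le (hy j))]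
        · refine le_max_of_le_left ?_
          simpa [hj] using norm_le_pi_norm (b⁻¹ * y) j
    rw [integral_congr_ae (h0.mono hmax), integral_congr_ae (h0'.mono hmax)]
    refine h _ fun j => ?_
    by_cases hj : j = i
    · subst hj; simpa using ha0
    · simpa [hj] using hb j
  · have hz : ∀ ρ : Measure (ι → ℝ), (∀ᵐ z ∂ρ, 0 ≤ z ∧ z i = 1) → ρ (Set.Iic b) = 0 := by
      intro ρ hρ
      exact measure_mono_null (fun y hy (hy0 : 0 ≤ y ∧ y i = 1) => hbi (hy0.2 ▸ hy i)) hρ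
    rw [hz _ (ae_tilt h0 i), hz _ (ae_tilt h0' i)]

/-- For nonnegative vectors, the zonoid and the max-zonoid determine each other. -/
theorem integral_abs_eq_iff_integral_norm_eq (h0 : ∀ᵐ y ∂μ, 0 ≤ y) (h0' : ∀ᵐ y ∂μ', 0 ≤ y)
    (hi : ∀ i, Integrable (fun y => y i) μ) (hi' : ∀ i, Integrable (fun y => y i) μ') :
    (∀ u : ι → ℝ, ∫ y, |∑ i, u i * y i| ∂μ = ∫ y, |∑ i, u i * y i| ∂μ') ↔
      ∀ v : ι → ℝ, (∀ i, 0 < v i) → ∫ y, ‖v * y‖ ∂μ = ∫ y, ‖v * y‖ ∂μ' := by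
  constructor
  · intro h v _
    have hv : ∀ (ρ : Measure (ι → ℝ)), (∀ i, Integrable (fun y => y i) ρ) →
        Integrable (fun y => ‖v * y‖) ρ := fun ρ hρ =>
      Integrable.norm (Integrable.of_eval fun j => (hρ j).const_mul _)
    refine integral_eq_of_tilt_eq h0 h0' (tilt_eq_of_integral_abs_eq h0 h0' hi hi' h)
      (by fun_prop) (fun c hc y => ?_) (hv μ hi) (hv μ' hi')
    rw [mul_smul_comm, norm_smul, Real.norm_of_nonneg hc]
  · intro h u
    have hu : ∀ (ρ : Measure (ι → ℝ)), (∀ i, Integrable (fun y => y i) ρ) →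
        Integrable (fun y => |∑ j, u j * y j|) ρ := fun ρ hρ =>
      (integrable_finsetSum _ fun j _ => (hρ j).const_mul _).abs
    refine integral_eq_of_tilt_eq h0 h0' (tilt_eq_of_integral_norm_eq h0 h0' hi hi' h)
      (by fun_prop) (fun c hc y => ?_) (hu μ hi) (hu μ' hi')
    simp only [Pi.smul_apply, smul_eq_mul, mul_left_comm _ c, ← Finset.mul_sum]
    rw [abs_mul, abs_of_nonneg hc]

end Tilt

/-! ### Laws of LePage sums and maxima. -/

namespace IsLePageInput

variable {T Ω S : Type*} [MeasurableSpace Ω] [MeasurableSpace S] {P : Measure Ω} {Q : Measure S}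
  {ξ : S → T → ℝ} {ζ : ℕ → Ω → ℝ} {ξs : ℕ → Ω → T → ℝ}

theorem measurable_lePageTerm (hL : IsLePageInput ζ ξs ξ P Q) (k : ℕ) (t : T) :
    Measurable fun ω => lePageTerm ζ ξs k ω t :=
  (Finset.measurable_sum _ fun i _ => hL.measurable_exp i).inv.mul
    ((measurable_pi_apply t).comp (hL.measurable_copy k))

theorem measurable_lePageMax (hL : IsLePageInput ζ ξs ξ P Q) (I : Finset T) :
    Measurable (fun ω => I.restrict (lePageMax ζ ξs ω)) :=
  measurable_pi_iff.2 fun t => Measurable.iSup fun k => hL.measurable_lePageTerm k t.1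

theorem integrable_map (hL : IsLePageInput ζ ξs ξ P Q) {φ : (T → ℝ) → ℝ} (hφ : Measurable φ)
    (hint : Integrable (fun s => φ (ξ s)) Q) :
    Integrable (fun x => x) (Q.map fun s => φ (ξ s)) :=
  (integrable_map_measure measurable_id.aestronglyMeasurable
    (hφ.comp hL.measurable_summand).aemeasurable).2 hint

theorem map_neg_eq (hL : IsLePageInput ζ ξs ξ P Q) (hsymm : IsSymmetricProcess ξ Q)
    {φ : (T → ℝ) → ℝ} (hφ : Measurable φ) (hneg : ∀ y, φ (-y) = -φ y) :
    (Q.map fun s => φ (ξ s)).map (fun x => -x) = Q.map fun s => φ (ξ s) := by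
  have hm : Measurable fun s => φ (ξ s) := hφ.comp hL.measurable_summand
  have h := (IdentDistrib.comp hsymm hφ).map_eq
  simp only [Function.comp_def, hneg] at h
  rw [Measure.map_map measurable_neg hm]
  exact h.symm

theorem ae_nonneg_copy (hL : IsLePageInput ζ ξs ξ P Q) {t : T} (h0 : ∀ᵐ s ∂Q, 0 ≤ ξ s t) :
    ∀ᵐ ω ∂P, ∀ k, 0 ≤ ξs k ω t :=
  ae_all_iff.2 fun k => (hL.law_copy k).symm.ae_snd (p := fun y : T → ℝ => 0 ≤ y t)
    (measurableSet_le measurable_const (measurable_pi_apply t)) h0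

variable [IsProbabilityMeasure Q]

theorem isProbabilityMeasure_map (hL : IsLePageInput ζ ξs ξ P Q) {E : Type*} [MeasurableSpace E]
    {φ : (T → ℝ) → E} (hφ : Measurable φ) : IsProbabilityMeasure (Q.map fun s => φ (ξ s)) :=
  Measure.isProbabilityMeasure_map (hφ.comp hL.measurable_summand).aemeasurable

variable [IsProbabilityMeasure P]

theorem ae_tendsto_lePageSum (hL : IsLePageInput ζ ξs ξ P Q)
    (hint : ∀ t, Integrable (fun s => ξ s t) Q) (hsymm : IsSymmetricProcess ξ Q) (t : T) :
    ∀ᵐ ω ∂P, Tendsto (fun n => lePagePartialSum ζ ξs n ω t) atTop (𝓝 (lePageSum ζ ξs ω t)) := by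
  have hφ : Measurable fun y : T → ℝ => y t := measurable_pi_apply t
  have := hL.isProbabilityMeasure_map hφ
  have hind : IndepFun (fun ω k => ζ k ω) (fun ω k => ξs k ω t) P :=
    hL.indep_exp_copy.comp measurable_id
      (ψ := fun x : ℕ → T → ℝ => fun k => x k t) (by fun_prop)
  filter_upwards [(hL.isMarkedArrival hφ).ae_exists_tendsto_sum hind
    (hL.integrable_map hφ (hint t)) (hL.map_neg_eq hsymm hφ fun _ => rfl)] with ω hω
  exact tendsto_nhds_limUnder hω

theorem aemeasurable_lePageSum (hL : IsLePageInput ζ ξs ξ P Q)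
    (hint : ∀ t, Integrable (fun s => ξ s t) Q) (hsymm : IsSymmetricProcess ξ Q) (I : Finset T) :
    AEMeasurable (fun ω => I.restrict (lePageSum ζ ξs ω)) P :=
  aemeasurable_pi_iff.2 fun t => aemeasurable_of_tendsto_metrizable_ae atTop
    (fun n => (Finset.measurable_sum (Finset.range n) fun k _ =>
      hL.measurable_lePageTerm k t.1).aemeasurable)
    (hL.ae_tendsto_lePageSum hint hsymm t)

/-- The characteristic function of the LePage series. -/
theorem integral_exp_lePageSum (hL : IsLePageInput ζ ξs ξ P Q)
    (hint : ∀ t, Integrable (fun s => ξ s t) Q) (hsymm : IsSymmetricProcess ξ Q) (I : Finset T)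
    (u : I → ℝ) :
    ∫ ω, Complex.exp ((∑ i, u i * I.restrict (lePageSum ζ ξs ω) i : ℝ) * Complex.I) ∂P =
      Real.exp (-((∫ x in Set.Ioi (0 : ℝ), (1 - Real.cos x⁻¹)) *
        ∫ s, |∑ i, u i * I.restrict (ξ s) i| ∂Q)) := by
  have hφ : Measurable fun y : T → ℝ => ∑ i, u i * I.restrict y i := by
    simp only [Finset.restrict]
    fun_prop
  have := hL.isProbabilityMeasure_map hφ
  have hm : Measurable fun s => ∑ i, u i * I.restrict (ξ s) i := hφ.comp hL.measurable_summand
  -- A linear form of the LePage sums is itself a LePage sum, whose marks are the linear form of the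
  -- copies.
  have h := (hL.isMarkedArrival hφ).integral_exp_sum
    (hL.integrable_map hφ (integrable_finsetSum _ fun i _ => (hint i).const_mul (u i)))
    (hL.map_neg_eq hsymm hφ fun y => by simp)
    (X := fun ω => ∑ i, u i * I.restrict (lePageSum ζ ξs ω) i) ?_
  · rw [h, integral_map hm.aemeasurable continuous_abs.aestronglyMeasurable]
  · filter_upwards [ae_all_iff.2 fun i : I => hL.ae_tendsto_lePageSum hint hsymm i] with ω hω
    refine (tendsto_finsetSum _ fun i _ => (hω i).const_mul (u i)).congr fun n => ?_
    simp only [lePagePartialSum, lePageTerm, Finset.mul_sum, Finset.restrict]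
    rw [Finset.sum_comm]
    exact Finset.sum_congr rfl fun k _ => Finset.sum_congr rfl fun i _ => by ring

theorem ae_arrival_pos (hL : IsLePageInput ζ ξs ξ P Q) :
    ∀ᵐ ω ∂P, ∀ k, 0 < ∑ i ∈ Finset.range (k + 1), ζ i ω := by
  have := hL.isProbabilityMeasure_map measurable_id
  filter_upwards [(hL.isMarkedArrival measurable_id).ae_gap_pos] with ω hω k
  exact Finset.sum_pos (fun i _ => hω i) ⟨0, by simp⟩

theorem ae_isGreatest_lePageMax (hL : IsLePageInput ζ ξs ξ P Q)
    (hint : ∀ t, Integrable (fun s => ξ s t) Q) {t : T} (h0 : ∀ᵐ s ∂Q, 0 ≤ ξ s t) :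
    ∀ᵐ ω ∂P, IsGreatest (Set.range fun k => lePageTerm ζ ξs k ω t) (lePageMax ζ ξs ω t) := by
  have hφ : Measurable fun y : T → ℝ => y t := measurable_pi_apply t
  have := hL.isProbabilityMeasure_map hφ
  filter_upwards [(hL.isMarkedArrival hφ).ae_tendsto_inv_arrival_mul
    (hL.integrable_map hφ (hint t)), hL.ae_nonneg_copy h0, hL.ae_arrival_pos] with ω h1 h2 h3
  exact isGreatest_iSup_of_tendsto_zero (fun k => mul_nonneg (inv_nonneg.2 (h3 k).le) (h2 k)) h1

theorem ae_nonneg_lePageMax (hL : IsLePageInput ζ ξs ξ P Q)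
    (h0 : ∀ t, ∀ᵐ s ∂Q, 0 ≤ ξ s t) (I : Finset T) :
    ∀ᵐ y ∂(P.map fun ω => I.restrict (lePageMax ζ ξs ω)), 0 ≤ y := by
  rw [ae_map_iff (hL.measurable_lePageMax I).aemeasurable measurableSet_Ici]
  filter_upwards [ae_all_iff.2 fun i : I => hL.ae_nonneg_copy (h0 i), hL.ae_arrival_pos]
    with ω h1 h2 i
  exact Real.iSup_nonneg fun k => mul_nonneg (inv_nonneg.2 (h2 k).le) (h1 i k)

/-- The distribution function of the maximum of LePage terms. -/
theorem measureReal_lePageMax_le (hL : IsLePageInput ζ ξs ξ P Q)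
    (hint : ∀ t, Integrable (fun s => ξ s t) Q) (h0 : ∀ t, ∀ᵐ s ∂Q, 0 ≤ ξ s t) (I : Finset T)
    {b : I → ℝ} (hb : ∀ i, 0 < b i) :
    (P.map fun ω => I.restrict (lePageMax ζ ξs ω)).real (Set.Iic b) =
      Real.exp (-∫ y, ‖b⁻¹ * y‖ ∂(Q.map fun s => I.restrict (ξ s))) := by
  have hr : Measurable fun y : T → ℝ => I.restrict y := by
    simp only [Finset.restrict_def]
    fun_prop
  have hφ : Measurable fun y : T → ℝ => ‖b⁻¹ * I.restrict y‖ := by fun_prop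
  have := hL.isProbabilityMeasure_map hφ
  have hm : Measurable fun s => ‖b⁻¹ * I.restrict (ξ s)‖ := hφ.comp hL.measurable_summand
  have hmr : Measurable fun s => I.restrict (ξ s) := hr.comp hL.measurable_summand
  have hi : Integrable (fun s => ‖b⁻¹ * I.restrict (ξ s)‖) Q :=
    Integrable.norm (Integrable.of_eval fun i => (hint i).const_mul _)
  have h := (hL.isMarkedArrival hφ).measureReal_forall_mark_le (hL.integrable_map hφ hi)
  rw [integral_map hm.aemeasurable (by fun_prop)] at h
  simp only [max_eq_left (norm_nonneg _)] at h
  rw [integral_map hmr.aemeasurable (by fun_prop), ← h, Measure.real, Measure.real,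
    Measure.map_apply (hL.measurable_lePageMax I) measurableSet_Iic]
  congr 1
  -- Almost surely the supremum is attained, so it is a genuine bound and not a default value; hence
  -- it lies below b exactly when every norm mark is at most its arrival time.
  refine measure_congr ?_
  filter_upwards [ae_all_iff.2 fun i : I => hL.ae_nonneg_copy (h0 i), hL.ae_arrival_pos,
    ae_all_iff.2 fun i : I => hL.ae_isGreatest_lePageMax hint (h0 i)] with ω h1 h2 h3
  refine propext ?_
  change I.restrict (lePageMax ζ ξs ω) ≤ b ↔
    ∀ k, ‖b⁻¹ * I.restrict (ξs k ω)‖ ≤ ∑ i ∈ Finset.range (k + 1), ζ i ω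
  have hle : ∀ (i : I) k, lePageTerm ζ ξs k ω i ≤ b i ↔
      ‖(b⁻¹ * I.restrict (ξs k ω)) i‖ ≤ ∑ i ∈ Finset.range (k + 1), ζ i ω := by
    intro i k
    rw [lePageTerm, Pi.mul_apply, Pi.inv_apply, Finset.restrict, Real.norm_of_nonneg
      (mul_nonneg (inv_nonneg.2 (hb i).le) (h1 i k)), inv_mul_le_iff₀ (h2 k),
      inv_mul_le_iff₀ (hb i), mul_comm]
  simp only [fun k => pi_norm_le_iff_of_nonneg (x := b⁻¹ * I.restrict (ξs k ω)) (h2 k).le, ← hle]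
  constructor
  · intro hy k i
    exact ((h3 i).2 ⟨k, rfl⟩).trans (hy i)
  · intro hy i
    obtain ⟨k, hk⟩ := (h3 i).1
    change lePageMax ζ ξs ω i ≤ b i
    rw [← hk]
    exact hy k i

end IsLePageInput

/-! ### The two equivalences. -/

section Equivalence

variable {T Ω Ω' S S' : Type*}
  [MeasurableSpace Ω] [MeasurableSpace Ω'] [MeasurableSpace S] [MeasurableSpace S']
  {P : Measure Ω} [IsProbabilityMeasure P] {P' : Measure Ω'} [IsProbabilityMeasure P']
  {Q : Measure S} [IsProbabilityMeasure Q] {Q' : Measure S'} [IsProbabilityMeasure Q']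
  {ξ : S → T → ℝ} {ξ' : S' → T → ℝ} {ζ : ℕ → Ω → ℝ} {ζ' : ℕ → Ω' → ℝ}
  {ξs : ℕ → Ω → T → ℝ} {ξs' : ℕ → Ω' → T → ℝ}

theorem sameDistribution_lePageSum_iff
    (hL : IsLePageInput ζ ξs ξ P Q) (hL' : IsLePageInput ζ' ξs' ξ' P' Q')
    (hint : ∀ t, Integrable (fun s => ξ s t) Q) (hint' : ∀ t, Integrable (fun s => ξ' s t) Q')
    (hs : IsSymmetricProcess ξ Q) (hs' : IsSymmetricProcess ξ' Q') :
    SameDistribution (lePageSum ζ ξs) (lePageSum ζ' ξs') P P' ↔ ZonoidEquivalent ξ ξ' Q Q' := by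
  refine forall_congr' fun I => ?_
  have hX := hL.aemeasurable_lePageSum hint hs I
  have hX' := hL'.aemeasurable_lePageSum hint' hs' I
  constructor
  · intro h u
    have h1 := (h.comp (u := fun y : I → ℝ => Complex.exp ((∑ i, u i * y i : ℝ) * Complex.I))
      (by fun_prop)).integral_eq
    simp only [Function.comp_def] at h1
    rw [hL.integral_exp_lePageSum hint hs, hL'.integral_exp_lePageSum hint' hs'] at h1
    have h2 := neg_injective (Real.exp_injective (Complex.ofReal_injective h1))
    -- Positivity of the cosine constant is what allows the zonoid functional to be read off the
    -- exponent.
    exact mul_left_cancel₀ integral_one_sub_cos_inv_pos.ne' h2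
  · intro h
    refine ⟨hX, hX', ?_⟩
    have := Measure.isProbabilityMeasure_map hX
    have := Measure.isProbabilityMeasure_map hX'
    refine Measure.ext_of_charFunDual (funext fun L => ?_)
    obtain ⟨u, hu⟩ := L.exists_eq_sum_mul
    rw [charFunDual_apply, charFunDual_apply, integral_map hX (by fun_prop),
      integral_map hX' (by fun_prop)]
    simp only [hu]
    rw [hL.integral_exp_lePageSum hint hs, hL'.integral_exp_lePageSum hint' hs', h]

theorem sameDistribution_lePageMax_iff
    (hL : IsLePageInput ζ ξs ξ P Q) (hL' : IsLePageInput ζ' ξs' ξ' P' Q')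
    (hint : ∀ t, Integrable (fun s => ξ s t) Q) (hint' : ∀ t, Integrable (fun s => ξ' s t) Q')
    (h0 : ∀ t, ∀ᵐ s ∂Q, 0 ≤ ξ s t) (h0' : ∀ t, ∀ᵐ s ∂Q', 0 ≤ ξ' s t) :
    SameDistribution (lePageMax ζ ξs) (lePageMax ζ' ξs') P P' ↔ ZonoidEquivalent ξ ξ' Q Q' := by
  refine forall_congr' fun I => ?_
  have hr : Measurable fun y : T → ℝ => I.restrict y := by
    simp only [Finset.restrict_def]
    fun_prop
  have hm : Measurable fun s => I.restrict (ξ s) := hr.comp hL.measurable_summand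
  have hm' : Measurable fun s => I.restrict (ξ' s) := hr.comp hL'.measurable_summand
  have hY := hL.measurable_lePageMax I
  have hY' := hL'.measurable_lePageMax I
  have key := integral_abs_eq_iff_integral_norm_eq (μ := Q.map fun s => I.restrict (ξ s))
    (μ' := Q'.map fun s => I.restrict (ξ' s))
    ((ae_map_iff hm.aemeasurable measurableSet_Ici).2 (ae_all_iff.2 fun i : I => h0 i))
    ((ae_map_iff hm'.aemeasurable measurableSet_Ici).2 (ae_all_iff.2 fun i : I => h0' i))
    (fun i => (integrable_map_measure (measurable_pi_apply i).aestronglyMeasurable hm.aemeasurable).2 (hint i))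
    (fun i => (integrable_map_measure (measurable_pi_apply i).aestronglyMeasurable hm'.aemeasurable).2 (hint' i))
  have hz : VectorZonoidEquivalent (fun s => I.restrict (ξ s)) (fun s => I.restrict (ξ' s)) Q Q' ↔
      ∀ u : I → ℝ, ∫ y, |∑ i, u i * y i| ∂(Q.map fun s => I.restrict (ξ s)) =
        ∫ y, |∑ i, u i * y i| ∂(Q'.map fun s => I.restrict (ξ' s)) := by
    refine forall_congr' fun u => ?_
    have hu : Measurable fun y : I → ℝ => |∑ i, u i * y i| := by fun_prop
    rw [integral_map hm.aemeasurable hu.aestronglyMeasurable,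
      integral_map hm'.aemeasurable hu.aestronglyMeasurable]
  rw [hz, key]
  have := Measure.isProbabilityMeasure_map (μ := P) hY.aemeasurable
  have := Measure.isProbabilityMeasure_map (μ := P') hY'.aemeasurable
  constructor
  · intro h v hv
    have hv' : ∀ i, 0 < v⁻¹ i := fun i => inv_pos.2 (hv i)
    have h1 := hL.measureReal_lePageMax_le hint h0 I hv'
    rw [h.map_eq, hL'.measureReal_lePageMax_le hint' h0' I hv', inv_inv] at h1
    exact (neg_injective (Real.exp_injective h1)).symm
  · intro h
    refine ⟨hY.aemeasurable, hY'.aemeasurable, ?_⟩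
    refine measure_ext_of_Iic_pos (hL.ae_nonneg_lePageMax h0 I) (hL'.ae_nonneg_lePageMax h0' I)
      fun b hb => ?_
    rw [← ENNReal.toReal_eq_toReal_iff' (measure_ne_top _ _) (measure_ne_top _ _)]
    have h1 := hL.measureReal_lePageMax_le hint h0 I hb
    have h2 := hL'.measureReal_lePageMax_le hint' h0' I hb
    rw [← h b⁻¹ fun i => inv_pos.2 (hb i), ← h1] at h2
    exact h2.symm

end Equivalence

theorem mainTheorem6 {T Ω Ω' S S' : Type*}
    [MeasurableSpace Ω] [MeasurableSpace Ω'] [MeasurableSpace S] [MeasurableSpace S']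
    (P : Measure Ω) [IsProbabilityMeasure P] (P' : Measure Ω') [IsProbabilityMeasure P']
    (Q : Measure S) [IsProbabilityMeasure Q] (Q' : Measure S') [IsProbabilityMeasure Q']
    (ξ : S → T → ℝ) (ξ' : S' → T → ℝ)
    (ζ : ℕ → Ω → ℝ) (ζ' : ℕ → Ω' → ℝ)
    (ξs : ℕ → Ω → T → ℝ) (ξs' : ℕ → Ω' → T → ℝ)
    (hL : IsLePageInput ζ ξs ξ P Q) (hL' : IsLePageInput ζ' ξs' ξ' P' Q')
    (hint : ∀ t, Integrable (fun s => ξ s t) Q)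
    (hint' : ∀ t, Integrable (fun s => ξ' s t) Q') :
    (IsSymmetricProcess ξ Q → IsSymmetricProcess ξ' Q' →
      (∀ t, ∀ᵐ ω ∂P,
        Tendsto (fun n => lePagePartialSum ζ ξs n ω t) atTop (𝓝 (lePageSum ζ ξs ω t))) ∧
      (∀ t, ∀ᵐ ω ∂P',
        Tendsto (fun n => lePagePartialSum ζ' ξs' n ω t) atTop (𝓝 (lePageSum ζ' ξs' ω t))) ∧
      (SameDistribution (lePageSum ζ ξs) (lePageSum ζ' ξs') P P' ↔
        ZonoidEquivalent ξ ξ' Q Q')) ∧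
    ((∀ t, ∀ᵐ s ∂Q, 0 ≤ ξ s t) → (∀ t, ∀ᵐ s ∂Q', 0 ≤ ξ' s t) →
      (∀ t, ∀ᵐ ω ∂P,
        IsGreatest (Set.range fun k => lePageTerm ζ ξs k ω t) (lePageMax ζ ξs ω t)) ∧
      (∀ t, ∀ᵐ ω ∂P',
        IsGreatest (Set.range fun k => lePageTerm ζ' ξs' k ω t) (lePageMax ζ' ξs' ω t)) ∧
      (SameDistribution (lePageMax ζ ξs) (lePageMax ζ' ξs') P P' ↔
        ZonoidEquivalent ξ ξ' Q Q')) :=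
  ⟨fun hs hs' => ⟨hL.ae_tendsto_lePageSum hint hs, hL'.ae_tendsto_lePageSum hint' hs',
      sameDistribution_lePageSum_iff hL hL' hint hint' hs hs'⟩,
    fun h0 h0' => ⟨fun t => hL.ae_isGreatest_lePageMax hint (h0 t),
      fun t => hL'.ae_isGreatest_lePageMax hint' (h0' t),
      sameDistribution_lePageMax_iff hL hL' hint hint' h0 h0'⟩⟩
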